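/- Let $m>1$ and $n\ge 1$ be integers. A linear cellular automaton (LCA) over $(\mathbb{Z}/m\mathbb{Z})^n$ is a map $\mathcal F$ on $((\mathbb{Z}/m\mathbb{Z})^n)^{\mathbb{Z}}$ of the form $\mathcal F(c)_i=\sum_{z=-r}^{r}A_z\,c_{i+z}$ with $r\in\mathbb{N}$ and $A_{-r},\dots,A_r\in(\mathbb{Z}/m\mathbb{Z})^{n\times n}$; the matrix associated with $\mathcal F$ is $A=\sum_{z=-r}^{r}A_zX^{-z}$, an $n\times n$ matrix over the Laurent polynomial ring $(\mathbb{Z}/m\mathbb{Z})[X,X^{-1}]$. Let $d$ be the Tychonoff distance $d(c,c')=2^{-\min\{|j|\,:\,c_j\neq c'_j\}}$ for $c\ne c'$, and $d(c,c)=0$. The LCA $\mathcal F$ is positively expansive if there is $\varepsilon>0$ such that for all configurations $c\neq c'$ there is a natural number $\ell\ge 0$ with $d(\mathcal F^{\ell}(c),\mathcal F^{\ell}(c'))\ge\varepsilon$. For a nonzero Laurent polynomial $\alpha$ let $\deg^+(\alpha)$ and $\deg^-(\alpha)$ be the maximum and the minimum degree of its monomials, and put $\deg^+(0)=-\infty$,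 $\deg^-(0)=+\infty$. A square matrix over a Laurent polynomial ring is expansive if its characteristic polynomial $\alpha_0+\alpha_1t+\dots+\alpha_{n-1}t^{n-1}+t^n$ satisfies $\alpha_0\ne0$, $\deg^+(\alpha_0)>0$, $\deg^-(\alpha_0)<0$, and $\deg^+(\alpha_0)>\deg^+(\alpha_i)$ and $\deg^-(\alpha_0)<\deg^-(\alpha_i)$ for every $i\in\{1,\dots,n-1\}$. Then: (1) For all $m>1$ and $n\ge1$, an LCA over $(\mathbb{Z}/m\mathbb{Z})^n$ with associated matrix $A$ is positively expansive if and only if, for every prime $p$ dividing $m$, the matrix $A \bmod p$ over $(\mathbb{Z}/p\mathbb{Z})[X,X^{-1}]$, obtained by reducing all coefficients modulo $p$, is expansive. (2) Positive expansivity is decidable for LCA over $(\mathbb{Z}/m\mathbb{Z})^n$, uniformly in $m$ and $n$: there is an algorithm (a total computable function) which, given $m>1$, $n\ge1$, $r\in\mathbb{N}$ and the matrices $A_{-r},\dots,A_r\in(\mathbb{Z}/m\mathbb{Z})^{n\times n}$, decides whether the LCA they define is positively expansive. -/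

import Mathlib

noncomputable section

namespace LinearCA

/-- The standard Tychonoff distance on configurations: `d(c, c') = 2 ^ (-k)`, where `k` is the
least `|j|` with `c j ≠ c' j`, and `d(c, c) = 0`. -/
def tychonoffDist {S : Type*} (c c' : ℤ → S) : ℝ :=
  open Classical in
  if c = c' then 0 else (2 : ℝ)⁻¹ ^ sInf {k : ℕ | ∃ j : ℤ, j.natAbs = k ∧ c j ≠ c' j}

/-- The global rule of the one-dimensional cellular automaton with radius `r` and local rule `f`.
The argument `k : Fin (2 * r + 1)` of the local rule stands for the offset `k - r ∈ [-r, r]`. -/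
def globalRule {S : Type*} (r : ℕ) (f : (Fin (2 * r + 1) → S) → S) (c : ℤ → S) : ℤ → S :=
  fun i => f fun k => c (i + ((k : ℤ) - (r : ℤ)))

/-- Positive expansivity of a transformation of a configuration space. -/
def PositivelyExpansive {S : Type*} (F : (ℤ → S) → (ℤ → S)) : Prop :=
  ∃ ε : ℝ, 0 < ε ∧ ∀ c c' : ℤ → S, c ≠ c' → ∃ l : ℕ, ε ≤ tychonoffDist (F^[l] c) (F^[l] c')

/-- A linear local rule over `(ℤ/mℤ)^n`: a radius `r` and matrices `A_{-r}, …, A_r`.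
The matrix `A_z` is `mat k` for the index `k = z + r`. -/
structure LinearRule (m n : ℕ) where
  radius : ℕ
  mat : Fin (2 * radius + 1) → Matrix (Fin n) (Fin n) (ZMod m)

namespace LinearRule

variable {m n : ℕ}

/-- The local rule `(x_{-r}, …, x_r) ↦ ∑_z A_z x_z`. -/
def localRule (A : LinearRule m n) (x : Fin (2 * A.radius + 1) → (Fin n → ZMod m)) :
    Fin n → ZMod m :=
  ∑ k, (A.mat k).mulVec (x k)

/-- The linear cellular automaton (its global rule) defined by a linear local rule. -/
def automaton (A : LinearRule m n) : (ℤ → (Fin n → ZMod m)) → (ℤ → (Fin n → ZMod m)) :=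
  globalRule A.radius A.localRule

/-- The matrix `∑_{z = -r}^{r} A_z X^{-z}` of Laurent polynomials associated with a linear
cellular automaton. -/
def assocMatrix (A : LinearRule m n) : Matrix (Fin n) (Fin n) (LaurentPolynomial (ZMod m)) :=
  Matrix.of fun i j => ∑ k : Fin (2 * A.radius + 1),
    LaurentPolynomial.C (A.mat k i j) * LaurentPolynomial.T (-((k : ℤ) - (A.radius : ℤ)))

/-- The finite description `(m, n, r, [A_{-r}, …, A_r])` of a linear cellular automaton: each
matrix is the list of its rows, a row is the list of its entries, and an entry of `ℤ/mℤ` is given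
by its representative in `{0, …, m - 1}`. -/
def code (A : LinearRule m n) : ℕ × ℕ × ℕ × List (List (List ℕ)) :=
  (m, n, A.radius, List.ofFn fun k => List.ofFn fun i => List.ofFn fun j => (A.mat k i j).val)

end LinearRule

/-- The positive degree: the maximal degree of a monomial, and `-∞` for `0`. -/
def posDeg {R : Type*} [Semiring R] (a : LaurentPolynomial R) : WithBot ℤ :=
  a.coeff.support.max

/-- The negative degree: the minimal degree of a monomial, and `+∞` for `0`. -/
def negDeg {R : Type*} [Semiring R] (a : LaurentPolynomial R) : WithTop ℤ :=
  a.coeff.support.min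

/-- Expansivity of a monic polynomial `α₀ + α₁ t + ⋯ + α_{n-1} t^{n-1} + t^n` over the Laurent
polynomials. -/
def ExpansivePoly {R : Type*} [Semiring R] (π : Polynomial (LaurentPolynomial R)) : Prop :=
  π.coeff 0 ≠ 0 ∧
  (0 < posDeg (π.coeff 0) ∧
    ∀ i : ℕ, 1 ≤ i → i < π.natDegree → posDeg (π.coeff i) < posDeg (π.coeff 0)) ∧
  (negDeg (π.coeff 0) < 0 ∧
    ∀ i : ℕ, 1 ≤ i → i < π.natDegree → negDeg (π.coeff 0) < negDeg (π.coeff i))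

/-- A matrix of Laurent polynomials is expansive if its characteristic polynomial is. -/
def ExpansiveMatrix {R : Type*} [CommRing R] {n : ℕ}
    (A : Matrix (Fin n) (Fin n) (LaurentPolynomial R)) : Prop :=
  ExpansivePoly A.charpoly

/-- Reduction modulo a divisor `q` of `m` of all coefficients of a matrix of Laurent polynomials
over `ℤ/mℤ`. -/
def reduceMod {m n q : ℕ} (h : q ∣ m)
    (A : Matrix (Fin n) (Fin n) (LaurentPolynomial (ZMod m))) :
    Matrix (Fin n) (Fin n) (LaurentPolynomial (ZMod q)) :=
  A.map (AddMonoidAlgebra.mapRingHom ℤ (ZMod.castHom h (ZMod q)))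

end LinearCA

end

/-! A linear automaton `F` is positively expansive iff, for some window `[-N, N]`, no nonzero
configuration is *invisible*, that is, has its whole orbit vanishing on the window. Over an
Artinian ring `R` it suffices to consider the residue fields: an invisible submodule that is not
zero has an associated prime, hence an element killed by a maximal ideal `𝔪`; conversely `R ⧸ 𝔪`
embeds into `R`.

Over a field, suppose that the constant coefficient of the characteristic polynomial dominates
the others on both sides. Then the Cayley–Hamilton relation, read at the right cell, expresses
the cell next to a large window through cells of the window at later times, so every window of
invisibility grows and fills `ℤ`. For the converse, configurations are the linear functionals on
Laurent vectors; that none is invisible means that the row vectors `T ^ s • e_k * A ^ l` with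
`|s| ≤ N` span. Extend the degree to a valuation `v` on an algebraic closure of the field of
Laurent fractions and pair with an eigenvector of `A` for the eigenvalue `x`. If `v x ≤ 1`, the
valuations of the pairings of the spanning vectors are bounded, whereas those of all Laurent
vectors are not. Hence all eigenvalues have `v x > 1`, and their product strictly dominates the
other elementary symmetric functions.

For radius `r` and `n` components the window `[-n * r, n * r]` and `n` time steps are enough for
the growth. This is a statement about finite pieces of space-time diagrams, which are coded by
the digits of bounded numbers, so positive expansivity is decided by a formula with bounded
quantifiers. -/

noncomputable section

namespace LinearCA

open LaurentPolynomial

section Dynamics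

theorem two_inv_pow_le_tychonoffDist_iff {S : Type*} (N : ℕ) (c c' : ℤ → S) :
    (2 : ℝ)⁻¹ ^ N ≤ tychonoffDist c c' ↔ ∃ j : ℤ, j.natAbs ≤ N ∧ c j ≠ c' j := by
  unfold tychonoffDist
  split_ifs with h
  · subst h
    simp
  · have hne : {k : ℕ | ∃ j : ℤ, j.natAbs = k ∧ c j ≠ c' j}.Nonempty := by
      obtain ⟨j, hj⟩ := Function.ne_iff.1 h
      exact ⟨_, j, rfl, hj⟩
    rw [pow_le_pow_iff_right_of_lt_one₀ (by norm_num) (by norm_num)]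
    constructor
    · intro hN
      obtain ⟨j, hj, hcj⟩ := Nat.sInf_mem hne
      exact ⟨j, hj.trans_le hN, hcj⟩
    · rintro ⟨j, hj, hcj⟩
      have hmin : sInf {k : ℕ | ∃ j : ℤ, j.natAbs = k ∧ c j ≠ c' j} ≤ j.natAbs :=
        Nat.sInf_le ⟨j, rfl, hcj⟩
      exact hmin.trans hj

theorem positivelyExpansive_iff_exists_window {S : Type*} (F : (ℤ → S) → (ℤ → S)) :
    PositivelyExpansive F ↔ ∃ N : ℕ, ∀ c c' : ℤ → S,
      (∀ (l : ℕ) (j : ℤ), j.natAbs ≤ N → F^[l] c j = F^[l] c' j) → c = c' := by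
  constructor
  · rintro ⟨ε, hε, h⟩
    obtain ⟨N, hN⟩ := exists_pow_lt_of_lt_one hε (show (2 : ℝ)⁻¹ < 1 by norm_num)
    refine ⟨N, fun c c' hc => by_contra fun hne => ?_⟩
    obtain ⟨l, hl⟩ := h c c' hne
    obtain ⟨j, hj, hcj⟩ := (two_inv_pow_le_tychonoffDist_iff N _ _).1 (hN.le.trans hl)
    exact hcj (hc l j hj)
  · rintro ⟨N, hN⟩
    refine ⟨(2 : ℝ)⁻¹ ^ N, by positivity, fun c c' hne => ?_⟩
    by_contra! hlt
    refine hne (hN c c' fun l j hj => by_contra fun hcj => ?_)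
    exact (hlt l).not_ge ((two_inv_pow_le_tychonoffDist_iff N _ _).2 ⟨j, hj, hcj⟩)

variable {R M : Type*} [Ring R] [AddCommGroup M] [Module R M]

/-- The configurations all of whose iterates under `F` vanish on the window `[-N, N]`. -/
def invisible (F : Module.End R (ℤ → M)) (N : ℕ) : Submodule R (ℤ → M) where
  carrier := {c | ∀ (l : ℕ) (j : ℤ), j.natAbs ≤ N → (F ^ l) c j = 0}
  add_mem' hc hc' l j hj := by simp [hc l j hj, hc' l j hj]
  zero_mem' l j _ := by simp
  smul_mem' a c hc l j hj := by simp [hc l j hj]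

theorem invisible_antitone (F : Module.End R (ℤ → M)) : Antitone (invisible F) :=
  fun _ _ h _ hc l j hj => hc l j (hj.trans h)

theorem pow_apply_mem_invisible {F : Module.End R (ℤ → M)} {N : ℕ} {c : ℤ → M}
    (hc : c ∈ invisible F N) (l : ℕ) : (F ^ l) c ∈ invisible F N := fun l' j hj => by
  rw [← Module.End.mul_apply, ← pow_add]
  exact hc _ j hj

theorem positivelyExpansive_iff_exists_invisible_eq_bot (F : Module.End R (ℤ → M)) :
    PositivelyExpansive F ↔ ∃ N, invisible F N = ⊥ := by
  rw [positivelyExpansive_iff_exists_window]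
  simp only [← Module.End.pow_apply]
  refine exists_congr fun N => ⟨fun h => ?_, fun h c c' hc => ?_⟩
  · refine (Submodule.eq_bot_iff _).2 fun c hc => h c 0 fun l j hj => ?_
    rw [hc l j hj, map_zero, Pi.zero_apply]
  · refine sub_eq_zero.1 ((Submodule.eq_bot_iff _).1 h _ fun l j hj => ?_)
    rw [map_sub, Pi.sub_apply, hc l j hj, sub_self]

variable (R M) in
/-- Translation of configurations to the right by `s` cells. -/
def shift (s : ℤ) : Module.End R (ℤ → M) := LinearMap.funLeft R M (· - s)

theorem shift_apply (s : ℤ) (c : ℤ → M) (j : ℤ) : shift R M s c j = c (j - s) := rfl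

theorem shift_zero (c : ℤ → M) : shift R M 0 c = c := by
  ext
  simp [shift_apply]

theorem shift_add (s t : ℤ) (c : ℤ → M) : shift R M (s + t) c = shift R M s (shift R M t c) := by
  ext j
  simp only [shift_apply, sub_sub]

/-- The first `L + 1` steps of an orbit, seen through the window `[-N, N]`, determine the initial
configuration at the two cells next to the window. -/
def WindowGrows (F : Module.End R (ℤ → M)) (N L : ℕ) : Prop :=
  ∀ c : ℤ → M, (∀ l ≤ L, ∀ j : ℤ, j.natAbs ≤ N → (F ^ l) c j = 0) →
    c (N + 1) = 0 ∧ c (-(N + 1)) = 0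

theorem WindowGrows.invisible_le_succ {F : Module.End R (ℤ → M)} {N L : ℕ}
    (h : WindowGrows F N L) : invisible F N ≤ invisible F (N + 1) := fun c hc l j hj => by
  have hborder := h ((F ^ l) c) fun l' _ => pow_apply_mem_invisible hc l l'
  obtain hle | rfl | rfl : j.natAbs ≤ N ∨ j = N + 1 ∨ j = -(N + 1) := by omega
  exacts [hc l j hle, hborder.1, hborder.2]

theorem WindowGrows.shift_mem_invisible {F : Module.End R (ℤ → M)} {N L : ℕ}
    (hF : ∀ s, Commute F (shift R M s)) (h : WindowGrows F N L) {c : ℤ → M}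
    (hc : c ∈ invisible F N) (s : ℤ) : shift R M s c ∈ invisible F N := by
  have hstep {c : ℤ → M} (hc : c ∈ invisible F N) {s : ℤ} (hs : s.natAbs = 1) :
      shift R M s c ∈ invisible F N := fun l j hj => by
    rw [← Module.End.mul_apply, ((hF s).pow_left l).eq, Module.End.mul_apply, shift_apply]
    exact h.invisible_le_succ hc l _ (by omega)
  induction s using Int.induction_on with
  | zero => simpa only [shift_zero] using hc
  | succ s ih =>
    rw [add_comm, shift_add]
    exact hstep ih rfl
  | pred s ih =>
    rw [sub_eq_neg_add, shift_add]
    exact hstep ih rfl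

theorem WindowGrows.invisible_eq_bot {F : Module.End R (ℤ → M)} {N L : ℕ}
    (hF : ∀ s, Commute F (shift R M s)) (h : WindowGrows F N L) : invisible F N = ⊥ :=
  (Submodule.eq_bot_iff _).2 fun c hc => funext fun j => by
    simpa [shift_apply] using h.shift_mem_invisible hF hc (-j) 0 0 (by simp)

end Dynamics

section LaurentMatrixAction

variable (R M : Type*) [CommRing R] [AddCommGroup M] [Module R M]

/-- The action of Laurent polynomials on configurations, where `T s` is the translation by `s`. -/
def laurentAction : R[T;T⁻¹] →ₐ[R] Module.End R (ℤ → M) :=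
  AddMonoidAlgebra.lift R (Module.End R (ℤ → M)) ℤ
    { toFun s := shift R M s.toAdd
      map_one' := LinearMap.ext shift_zero
      map_mul' _ _ := LinearMap.ext (shift_add _ _) }

variable (ι : Type*) [Fintype ι] [DecidableEq ι]

/-- Families of configurations, regarded as configurations of families. -/
def configurationSwap : (ι → ℤ → M) ≃ₗ[R] (ℤ → ι → M) where
  __ := Equiv.piComm fun (_ : ι) (_ : ℤ) => M
  map_add' _ _ := rfl
  map_smul' _ _ := rfl

variable {ι}

/-- The linear cellular automaton on `ι → M` of a matrix of Laurent polynomials. -/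
def matrixAction : Matrix ι ι R[T;T⁻¹] →ₐ[R] Module.End R (ℤ → ι → M) :=
  (LinearEquiv.conjAlgEquiv R (configurationSwap R M ι)).toAlgHom.comp
    ((endVecAlgEquivMatrixEnd ι R R (ℤ → M)).symm.toAlgHom.comp (laurentAction R M).mapMatrix)

variable {R M}

theorem laurentAction_C_mul_T (a : R) (s : ℤ) (c : ℤ → M) (j : ℤ) :
    laurentAction R M (C a * T s) c j = a • c (j - s) := by
  rw [← single_eq_C_mul_T, laurentAction, AddMonoidAlgebra.lift_single]
  rfl

theorem laurentAction_apply (a : R[T;T⁻¹]) (c : ℤ → M) (j : ℤ) :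
    laurentAction R M a c j = a.coeff.sum fun s x => x • c (j - s) := by
  simp [laurentAction, AddMonoidAlgebra.lift_apply, Finsupp.sum, shift_apply]

theorem laurentAction_T (s : ℤ) : laurentAction R M (T s) = shift R M s := by
  ext c j
  simpa [shift_apply] using laurentAction_C_mul_T (1 : R) s c j

theorem laurentAction_invert (a : R[T;T⁻¹]) (c : ℤ → M) (j : ℤ) :
    laurentAction R M (invert a) (fun s => c (-s)) j = laurentAction R M a c (-j) := by
  induction a using LaurentPolynomial.induction_on' with
  | add a b ha hb => simp only [map_add, LinearMap.add_apply, Pi.add_apply, ha, hb]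
  | C_mul_T s x =>
    rw [map_mul, invert_C, invert_T, laurentAction_C_mul_T, laurentAction_C_mul_T, neg_sub,
      neg_sub_left, neg_sub_left, add_comm]

theorem laurentAction_map {M' : Type*} [AddCommGroup M'] [Module R M'] (φ : M →ₗ[R] M')
    (a : R[T;T⁻¹]) (c : ℤ → M) (j : ℤ) :
    laurentAction R M' a (fun s => φ (c s)) j = φ (laurentAction R M a c j) := by
  simp only [laurentAction_apply, Finsupp.sum, map_sum, map_smul]

theorem laurentAction_baseChange {S : Type*} [CommRing S] [Algebra R S] [Module S M]
    [IsScalarTower R S M] (a : R[T;T⁻¹]) (c : ℤ → M) (j : ℤ) :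
    laurentAction S M (AddMonoidAlgebra.mapRingHom ℤ (algebraMap R S) a) c j =
      laurentAction R M a c j := by
  induction a using LaurentPolynomial.induction_on' with
  | add a b ha hb => simp only [map_add, LinearMap.add_apply, Pi.add_apply, ha, hb]
  | C_mul_T s x =>
    rw [laurentAction_C_mul_T, ← single_eq_C_mul_T, AddMonoidAlgebra.mapRingHom_single,
      single_eq_C_mul_T, laurentAction_C_mul_T, algebraMap_smul]

theorem matrixAction_apply (A : Matrix ι ι R[T;T⁻¹]) (c : ℤ → ι → M) (j : ℤ) (i : ι) :
    matrixAction R M A c j i = ∑ k, laurentAction R M (A i k) (fun s => c s k) j := by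
  change ((endVecAlgEquivMatrixEnd ι R R (ℤ → M)).symm _) _ i j = _
  simp only [RingHom.coe_coe, AlgHom.mapMatrix_apply, LinearEquiv.coe_coe,
    endVecAlgEquivMatrixEnd_symm_apply_apply, Matrix.map_apply, Finset.sum_apply]
  rfl

theorem matrixAction_row (A : Matrix ι ι R[T;T⁻¹]) (c : ℤ → ι → M) (i : ι) :
    (fun j => matrixAction R M A c j i) =
      ∑ k, laurentAction R M (A i k) (fun s => c s k) := by
  funext j
  rw [matrixAction_apply, Finset.sum_apply]

theorem matrixAction_smul (a : R[T;T⁻¹]) (A : Matrix ι ι R[T;T⁻¹]) (c : ℤ → ι → M) (j : ℤ)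
    (i : ι) : matrixAction R M (a • A) c j i =
      laurentAction R M a (fun s => matrixAction R M A c s i) j := by
  rw [matrixAction_row, map_sum, Finset.sum_apply, matrixAction_apply]
  simp only [Matrix.smul_apply, smul_eq_mul, map_mul, Module.End.mul_apply]

theorem matrixAction_T_smul_one (s : ℤ) :
    matrixAction R M ((T s : R[T;T⁻¹]) • (1 : Matrix ι ι R[T;T⁻¹])) = shift R (ι → M) s := by
  ext1 c
  funext j i
  rw [matrixAction_smul, laurentAction_T, map_one]
  rfl

theorem commute_matrixAction_shift (A : Matrix ι ι R[T;T⁻¹]) (s : ℤ) :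
    Commute (matrixAction R M A) (shift R (ι → M) s) := by
  rw [← matrixAction_T_smul_one]
  exact ((Commute.one_right A).smul_right _).map (matrixAction R M)

theorem matrixAction_invert (A : Matrix ι ι R[T;T⁻¹]) (c : ℤ → ι → M) :
    matrixAction R M (A.map invert) (fun s => c (-s)) = fun s => matrixAction R M A c (-s) := by
  funext j i
  simp only [matrixAction_apply, Matrix.map_apply]
  exact Finset.sum_congr rfl fun k _ => laurentAction_invert _ (fun s => c s k) j

theorem matrixAction_invert_pow (A : Matrix ι ι R[T;T⁻¹]) (l : ℕ) (c : ℤ → ι → M) (j : ℤ) :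
    (matrixAction R M (A.map invert) ^ l) (fun s => c (-s)) j =
      (matrixAction R M A ^ l) c (-j) := by
  induction l generalizing c with
  | zero => rfl
  | succ l ih =>
    rw [pow_succ, Module.End.mul_apply, matrixAction_invert, ih]
    rfl

theorem matrixAction_map {M' : Type*} [AddCommGroup M'] [Module R M'] (φ : M →ₗ[R] M')
    (A : Matrix ι ι R[T;T⁻¹]) (c : ℤ → ι → M) (j : ℤ) :
    matrixAction R M' A (fun s => φ ∘ c s) j = φ ∘ matrixAction R M A c j := by
  funext i
  simp only [matrixAction_apply, Function.comp_apply, map_sum]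
  exact Finset.sum_congr rfl fun k _ => laurentAction_map φ _ (fun s => c s k) j

theorem matrixAction_baseChange {S : Type*} [CommRing S] [Algebra R S] [Module S M]
    [IsScalarTower R S M] (A : Matrix ι ι R[T;T⁻¹]) (c : ℤ → ι → M) :
    matrixAction S M ((AddMonoidAlgebra.mapRingHom ℤ (algebraMap R S)).mapMatrix A) c =
      matrixAction R M A c := by
  funext j i
  simp only [matrixAction_apply, RingHom.mapMatrix_apply, Matrix.map_apply,
    laurentAction_baseChange]

theorem matrixAction_pow_map {M' : Type*} [AddCommGroup M'] [Module R M'] (φ : M →ₗ[R] M')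
    (A : Matrix ι ι R[T;T⁻¹]) (l : ℕ) (c : ℤ → ι → M) (j : ℤ) :
    (matrixAction R M' A ^ l) (fun s => φ ∘ c s) j = φ ∘ (matrixAction R M A ^ l) c j := by
  rw [← map_pow, ← map_pow, matrixAction_map]

theorem comp_mem_invisible {M' : Type*} [AddCommGroup M'] [Module R M'] (φ : M →ₗ[R] M')
    {A : Matrix ι ι R[T;T⁻¹]} {N : ℕ} {c : ℤ → ι → M}
    (hc : c ∈ invisible (matrixAction R M A) N) :
    (fun s => φ ∘ c s) ∈ invisible (matrixAction R M' A) N := fun l j hj => by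
  rw [matrixAction_pow_map, hc l j hj]
  exact funext fun _ => map_zero φ

theorem mem_invisible_of_comp {M' : Type*} [AddCommGroup M'] [Module R M'] {φ : M →ₗ[R] M'}
    (hφ : Function.Injective φ) {A : Matrix ι ι R[T;T⁻¹]} {N : ℕ} {c : ℤ → ι → M}
    (hc : (fun s => φ ∘ c s) ∈ invisible (matrixAction R M' A) N) :
    c ∈ invisible (matrixAction R M A) N := fun l j hj => funext fun i => hφ <| by
  have hval := congrFun (hc l j hj) i
  rw [matrixAction_pow_map] at hval
  rwa [Pi.zero_apply, map_zero]

end LaurentMatrixAction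

theorem LinearRule.automaton_eq_matrixAction {m n : ℕ} (A : LinearRule m n) :
    A.automaton = matrixAction (ZMod m) (ZMod m) A.assocMatrix := by
  funext c j i
  simp only [matrixAction_apply, assocMatrix, Matrix.of_apply, map_sum, LinearMap.sum_apply,
    Finset.sum_apply, laurentAction_C_mul_T, sub_neg_eq_add, automaton, globalRule, localRule,
    Matrix.mulVec, dotProduct, smul_eq_mul]
  exact Finset.sum_comm

open Polynomial

section ExpansivePoly

variable {R : Type*} [Semiring R]

theorem posDeg_zero : posDeg (0 : R[T;T⁻¹]) = ⊥ := degree_zero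

theorem posDeg_lt_posDeg_iff {a b : R[T;T⁻¹]} :
    posDeg a < posDeg b ↔ ∃ d, b.coeff d ≠ 0 ∧ ∀ s, a.coeff s ≠ 0 → s < d := by
  simp only [posDeg, Finset.max_eq_sup_coe, Finset.lt_sup_iff, Finsupp.mem_support_iff]
  refine exists_congr fun d => and_congr_right fun _ => ?_
  rw [Finset.sup_lt_iff (WithBot.bot_lt_coe d)]
  simp only [Finsupp.mem_support_iff, WithBot.coe_lt_coe]

theorem negDeg_lt_negDeg_iff {a b : R[T;T⁻¹]} :
    negDeg b < negDeg a ↔ ∃ d, b.coeff d ≠ 0 ∧ ∀ s, a.coeff s ≠ 0 → d < s := by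
  simp only [negDeg, Finset.min_eq_inf_withTop, Finset.inf_lt_iff, Finsupp.mem_support_iff]
  refine exists_congr fun d => and_congr_right fun _ => ?_
  rw [Finset.lt_inf_iff (WithTop.coe_lt_top d)]
  simp only [Finsupp.mem_support_iff, WithTop.coe_lt_coe]

theorem coeff_ne_zero_and_le_of_posDeg_eq {a : R[T;T⁻¹]} {d : ℤ} (h : posDeg a = d) :
    a.coeff d ≠ 0 ∧ ∀ s, a.coeff s ≠ 0 → s ≤ d :=
  ⟨Finsupp.mem_support_iff.1 (Finset.mem_of_max h), fun _ hs =>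
    Finset.le_max_of_eq (Finsupp.mem_support_iff.2 hs) h⟩

theorem lt_of_posDeg_lt {a : R[T;T⁻¹]} {d s : ℤ} (h : posDeg a < d) (hs : a.coeff s ≠ 0) : s < d :=
  WithBot.coe_lt_coe.1 ((Finset.le_max (Finsupp.mem_support_iff.2 hs)).trans_lt h)

theorem exists_posDeg_eq {a : R[T;T⁻¹]} (ha : a ≠ 0) : ∃ d : ℤ, posDeg a = d :=
  WithBot.ne_bot_iff_exists.1 (fun h => ha (degree_eq_bot_iff.1 h)) |>.imp fun _ => Eq.symm

theorem negDeg_lt_negDeg_iff_posDeg_invert {R : Type*} [CommSemiring R] {a b : R[T;T⁻¹]} :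
    negDeg b < negDeg a ↔ posDeg (invert a) < posDeg (invert b) := by
  simp only [negDeg_lt_negDeg_iff, posDeg_lt_posDeg_iff, invert_apply]
  rw [← (Equiv.neg ℤ).exists_congr_right]
  refine exists_congr fun d => and_congr_right fun _ => ?_
  rw [← (Equiv.neg ℤ).forall_congr_right]
  simp only [Equiv.neg_apply, neg_lt_neg_iff]

/-- The positive degree of the constant coefficient strictly exceeds those of all others. -/
def TopDominates (π : R[T;T⁻¹][X]) : Prop :=
  ∀ i ≠ 0, posDeg (π.coeff i) < posDeg (π.coeff 0)

theorem forall_coeff_iff_of_monic {π : R[T;T⁻¹][X]} (hπ : π.Monic) (hdeg : π.natDegree ≠ 0)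
    {P : R[T;T⁻¹] → Prop} (hP : P 1 → P 0) :
    (P 1 ∧ ∀ i, 1 ≤ i → i < π.natDegree → P (π.coeff i)) ↔ ∀ i ≠ 0, P (π.coeff i) := by
  refine ⟨fun ⟨h1, h⟩ i hi => ?_, fun h => ⟨?_, fun i hi _ => h i (by omega)⟩⟩
  · rcases lt_trichotomy i π.natDegree with hlt | rfl | hgt
    · exact h i (by omega) hlt
    · rwa [hπ.coeff_natDegree]
    · rw [coeff_eq_zero_of_natDegree_lt hgt]
      exact hP h1
  · simpa only [hπ.coeff_natDegree] using h _ hdeg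

theorem TopDominates.coeff_zero_ne_zero {π : R[T;T⁻¹][X]} (h : TopDominates π) :
    π.coeff 0 ≠ 0 := fun h0 => not_lt_bot (h0 ▸ h 1 one_ne_zero)

theorem TopDominates.le_of_coeff_ne_zero {π : R[T;T⁻¹][X]} (h : TopDominates π) {N : ℤ}
    (hN : ∀ s, (π.coeff 0).coeff s ≠ 0 → s ≤ N) (l : ℕ) {s : ℤ} (hs : (π.coeff l).coeff s ≠ 0) :
    s ≤ N := by
  rcases eq_or_ne l 0 with rfl | hl
  · exact hN s hs
  · obtain ⟨d, hd, hlt⟩ := posDeg_lt_posDeg_iff.1 (h l hl)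
    exact (hlt s hs).le.trans (hN d hd)

theorem expansivePoly_iff_topDominates {R : Type*} [CommRing R] [Nontrivial R]
    {π : R[T;T⁻¹][X]} (hπ : π.Monic) (hdeg : π.natDegree ≠ 0) :
    ExpansivePoly π ↔
      TopDominates π ∧ TopDominates (π.map (invert (R := R) : R[T;T⁻¹] →+* R[T;T⁻¹])) := by
  have hpos_one : posDeg (1 : R[T;T⁻¹]) = 0 := degree_T 0
  have hneg_one : negDeg (1 : R[T;T⁻¹]) = 0 := by
    rw [negDeg, ← T_zero, T, AddMonoidAlgebra.coeff_single,
      Finsupp.support_single _ one_ne_zero, Finset.min_singleton]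
    rfl
  have hneg_zero : negDeg (0 : R[T;T⁻¹]) = ⊤ := rfl
  have hpos := forall_coeff_iff_of_monic hπ hdeg
    (P := fun a => posDeg a < posDeg (π.coeff 0)) fun h => posDeg_zero (R := R) ▸ bot_lt_of_lt h
  have hneg := forall_coeff_iff_of_monic hπ hdeg
    (P := fun a => negDeg (π.coeff 0) < negDeg a) fun h => hneg_zero ▸ lt_top_of_lt h
  simp only [hpos_one, hneg_one] at hpos hneg
  rw [ExpansivePoly, hpos, hneg]
  simp only [TopDominates, coeff_map, RingHom.coe_coe, negDeg_lt_negDeg_iff_posDeg_invert]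
  exact and_iff_right_of_imp fun h => TopDominates.coeff_zero_ne_zero h.1

theorem expansivePoly_map_iff {S : Type*} [Semiring S] {f : R →+* S} (hf : Function.Injective f)
    (π : R[T;T⁻¹][X]) :
    ExpansivePoly (π.map (AddMonoidAlgebra.mapRingHom ℤ f)) ↔ ExpansivePoly π := by
  have hsupp (a : R[T;T⁻¹]) :
      (AddMonoidAlgebra.mapRingHom ℤ f a).coeff.support = a.coeff.support := by
    ext s
    simp [map_eq_zero_iff f hf]
  have hinj : Function.Injective (AddMonoidAlgebra.mapRingHom ℤ f) :=
    AddMonoidAlgebra.map_injective f.toAddMonoidHom hf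
  simp only [ExpansivePoly, posDeg, negDeg, coeff_map, hsupp, ne_eq,
    Polynomial.natDegree_map_eq_of_injective hinj, map_eq_zero_iff _ hinj]

end ExpansivePoly

section DegreeBounds

variable {R ι : Type*} [CommRing R] [Fintype ι] [DecidableEq ι]

theorem exists_toLaurent_eq_of_nonneg {a : R[T;T⁻¹]} (h : ∀ s, a.coeff s ≠ 0 → 0 ≤ s) :
    ∃ q : R[X], toLaurent q = a := by
  change a ∈ (toLaurent (R := R)).range
  rw [← AddMonoidAlgebra.sum_coeff_single a]
  refine sum_mem fun s hs => ?_
  obtain ⟨k, rfl⟩ := Int.eq_ofNat_of_zero_le (h s (Finsupp.mem_support_iff.1 hs))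
  exact ⟨Polynomial.C (a.coeff k) * X ^ k, by
    rw [toLaurent_C_mul_X_pow, single_eq_C_mul_T]⟩

theorem coeff_mul_T (a : R[T;T⁻¹]) (r s : ℤ) : (a * T r).coeff s = a.coeff (s - r) := by
  rw [T, AddMonoidAlgebra.coeff_mul_single_apply, mul_one, sub_eq_add_neg]

theorem neg_card_mul_le_of_coeff_det_ne_zero {A : Matrix ι ι R[T;T⁻¹]} {r : ℤ}
    (hA : ∀ i k s, (A i k).coeff s ≠ 0 → -r ≤ s) {s : ℤ} (hs : A.det.coeff s ≠ 0) :
    -(Fintype.card ι * r) ≤ s := by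
  have hpoly (i k : ι) : ∃ q : R[X], toLaurent q = A i k * T r :=
    exists_toLaurent_eq_of_nonneg fun s hs => by
      linarith [hA i k (s - r) (by rwa [coeff_mul_T] at hs)]
  choose B hB using hpoly
  have hdet : toLaurent (Matrix.of B).det = A.det * T (Fintype.card ι * r) := by
    have hmap : (toLaurent (R := R)).mapMatrix (Matrix.of B) = (T r : R[T;T⁻¹]) • A := by
      ext1 i k
      simp [hB]
    rw [RingHom.map_det, hmap, Matrix.det_smul, T_pow, mul_comm]
  have hmem : s + Fintype.card ι * r ∈ (toLaurent (Matrix.of B).det).coeff.support := by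
    rwa [hdet, Finsupp.mem_support_iff, coeff_mul_T, add_sub_cancel_right]
  rw [support_coeff_toLaurent, Finset.mem_map] at hmem
  obtain ⟨k, -, hk⟩ := hmem
  have : (k : ℤ) = s + Fintype.card ι * r := hk
  omega

/-- Every entry of the matrix is a Laurent polynomial supported in degrees `[-r, r]`. -/
def HasRadius (r : ℕ) (A : Matrix ι ι R[T;T⁻¹]) : Prop :=
  ∀ i k s, (A i k).coeff s ≠ 0 → s.natAbs ≤ r

theorem exists_hasRadius {ι : Type*} [Finite ι] (A : Matrix ι ι R[T;T⁻¹]) : ∃ r, HasRadius r A := by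
  cases nonempty_fintype ι
  exact ⟨Finset.univ.sup fun q : ι × ι => (A q.1 q.2).coeff.support.sup Int.natAbs, fun i k _ hs =>
    (Finset.le_sup (f := Int.natAbs) (Finsupp.mem_support_iff.2 hs)).trans
      (Finset.le_sup (f := fun q : ι × ι => (A q.1 q.2).coeff.support.sup Int.natAbs)
        (Finset.mem_univ (i, k)))⟩

omit [Fintype ι] [DecidableEq ι] in
theorem HasRadius.map_invert {r : ℕ} {A : Matrix ι ι R[T;T⁻¹]} (hA : HasRadius r A) :
    HasRadius r (A.map invert) := fun i k s hs => by
  simpa using hA i k (-s) (by simpa using hs)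

theorem charpoly_map_invert (A : Matrix ι ι R[T;T⁻¹]) :
    (A.map invert).charpoly = A.charpoly.map (invert (R := R) : R[T;T⁻¹] →+* R[T;T⁻¹]) :=
  Matrix.charpoly_map A (invert (R := R) : R[T;T⁻¹] →+* R[T;T⁻¹])

theorem HasRadius.neg_le_of_coeff_charpoly_zero_ne_zero {r : ℕ} {A : Matrix ι ι R[T;T⁻¹]}
    (hA : HasRadius r A) {s : ℤ} (hs : (A.charpoly.coeff 0).coeff s ≠ 0) :
    -((Fintype.card ι * r : ℕ) : ℤ) ≤ s := by
  rw [coeff_zero_eq_eval_zero, Matrix.eval_charpoly, map_zero, zero_sub] at hs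
  have hneg : ∀ i k s, ((-A) i k).coeff s ≠ 0 → -(r : ℤ) ≤ s := fun i k s hs => by
    have := hA i k s (by simpa using hs)
    omega
  exact_mod_cast neg_card_mul_le_of_coeff_det_ne_zero hneg hs

theorem HasRadius.natAbs_le_of_coeff_charpoly_zero_ne_zero {r : ℕ} {A : Matrix ι ι R[T;T⁻¹]}
    (hA : HasRadius r A) {s : ℤ} (hs : (A.charpoly.coeff 0).coeff s ≠ 0) :
    s.natAbs ≤ Fintype.card ι * r := by
  have hlower := hA.neg_le_of_coeff_charpoly_zero_ne_zero hs
  have hupper := hA.map_invert.neg_le_of_coeff_charpoly_zero_ne_zero (s := -s) (by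
    simpa [charpoly_map_invert] using hs)
  omega

theorem expansivePoly_charpoly_iff [Nontrivial R] [Nonempty ι]
    (A : Matrix ι ι R[T;T⁻¹]) : ExpansivePoly A.charpoly ↔
      TopDominates A.charpoly ∧ TopDominates (A.map invert).charpoly := by
  rw [charpoly_map_invert]
  refine expansivePoly_iff_topDominates A.charpoly_monic ?_
  rw [Matrix.charpoly_natDegree_eq_dim]
  exact Fintype.card_ne_zero

end DegreeBounds

section CayleyHamilton

variable {R M ι : Type*} [CommRing R] [AddCommGroup M] [Module R M] [Fintype ι] [DecidableEq ι]

theorem sum_laurentAction_charpoly_eq_zero (A : Matrix ι ι R[T;T⁻¹]) (c : ℤ → ι → M) (j : ℤ)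
    (i : ι) : ∑ l ∈ Finset.range (A.charpoly.natDegree + 1), laurentAction R M (A.charpoly.coeff l)
      (fun s => (matrixAction R M A ^ l) c s i) j = 0 := by
  have hCH := congrArg (matrixAction R M) A.aeval_self_charpoly
  rw [aeval_eq_sum_range, map_sum, map_zero] at hCH
  have hval := congrFun (congrFun (LinearMap.congr_fun hCH c) j) i
  simpa only [LinearMap.sum_apply, Finset.sum_apply, matrixAction_smul, map_pow,
    LinearMap.zero_apply, Pi.zero_apply] using hval

variable [IsDomain R] [Module.IsTorsionFree R M]

theorem eq_zero_of_topDominates_charpoly {A : Matrix ι ι R[T;T⁻¹]} (hA : TopDominates A.charpoly)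
    {N : ℕ} (hN : ∀ l s, (A.charpoly.coeff l).coeff s ≠ 0 → s.natAbs ≤ N) {c : ℤ → ι → M}
    (hc : ∀ l ≤ Fintype.card ι, ∀ j : ℤ, j.natAbs ≤ N → (matrixAction R M A ^ l) c j = 0) :
    c (-(N + 1)) = 0 := by
  obtain ⟨d, hd⟩ := exists_posDeg_eq hA.coeff_zero_ne_zero
  obtain ⟨hd0, hmax⟩ := coeff_ne_zero_and_le_of_posDeg_eq hd
  have hvanish (l : ℕ) (hl : l ≤ Fintype.card ι) (s : ℤ) (hs : (A.charpoly.coeff l).coeff s ≠ 0)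
      (hsd : s < d) : (matrixAction R M A ^ l) c (d - (N + 1) - s) = 0 := by
    have hdN := hN 0 d hd0
    have hsN := hN l s hs
    exact hc l hl _ (by omega)
  -- In row `d - (N + 1)` only the top term of the constant coefficient reads outside the window.
  funext i
  have hrow := sum_laurentAction_charpoly_eq_zero A c (d - (N + 1)) i
  simp only [laurentAction_apply, Finsupp.sum] at hrow
  rw [Finset.sum_eq_single 0, Finset.sum_eq_single d] at hrow
  · simpa [hd0] using hrow
  · intro s hs hne
    rw [Finsupp.mem_support_iff] at hs
    rw [hvanish 0 (Nat.zero_le _) s hs ((hmax s hs).lt_of_ne hne), Pi.zero_apply, smul_zero]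
  · exact fun h => absurd (Finsupp.mem_support_iff.2 hd0) h
  · intro l hl hl0
    rw [Finset.mem_range, Matrix.charpoly_natDegree_eq_dim, Nat.lt_succ_iff] at hl
    refine Finset.sum_eq_zero fun s hs => ?_
    rw [Finsupp.mem_support_iff] at hs
    rw [hvanish l hl s hs (lt_of_posDeg_lt (hd ▸ hA l hl0) hs), Pi.zero_apply, smul_zero]
  · simp

variable [Nonempty ι]

theorem HasRadius.windowGrows_of_expansivePoly_charpoly {A : Matrix ι ι R[T;T⁻¹]} {r : ℕ}
    (hr : HasRadius r A) (hA : ExpansivePoly A.charpoly) :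
    WindowGrows (matrixAction R M A) (Fintype.card ι * r) (Fintype.card ι) := by
  obtain ⟨htop, hbot⟩ := (expansivePoly_charpoly_iff A).1 hA
  have hN (l : ℕ) (s : ℤ) (hs : (A.charpoly.coeff l).coeff s ≠ 0) :
      s.natAbs ≤ Fintype.card ι * r := by
    have hzero {s : ℤ} := hr.natAbs_le_of_coeff_charpoly_zero_ne_zero (s := s)
    have hzero' {s : ℤ} := hr.map_invert.natAbs_le_of_coeff_charpoly_zero_ne_zero (s := s)
    have hupper := htop.le_of_coeff_ne_zero (N := ↑(Fintype.card ι * r))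
      (fun s hs => Int.le_natAbs.trans (by exact_mod_cast hzero hs)) l hs
    have hlower := hbot.le_of_coeff_ne_zero (N := ↑(Fintype.card ι * r))
      (fun s hs => Int.le_natAbs.trans (by exact_mod_cast hzero' hs)) l (s := -s)
      (by simpa [charpoly_map_invert] using hs)
    omega
  refine fun c hc => ⟨?_, eq_zero_of_topDominates_charpoly htop hN hc⟩
  have hmirror := eq_zero_of_topDominates_charpoly (c := fun s => c (-s)) hbot
    (fun l s hs => by simpa using hN l (-s) (by simpa [charpoly_map_invert] using hs))
    fun l hl j hj => by
      rw [matrixAction_invert_pow]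
      exact hc l hl _ (by rwa [Int.natAbs_neg])
  simpa only [neg_neg] using hmirror

end CayleyHamilton

section DegreeValuation

variable {K Γ : Type*} [Field K] [LinearOrderedCommGroupWithZero Γ] (v : Valuation K[T;T⁻¹] Γ)

theorem valuation_T (s : ℤ) : v (T s) = v (T 1) ^ s := by
  have hT : v (T 1) ≠ 0 := ((isUnit_T (R := K) 1).map v).ne_zero
  induction s using Int.induction_on with
  | zero => rw [T_zero, map_one, zpow_zero]
  | succ s ih => rw [T_add, map_mul, ih, zpow_add_one₀ hT]
  | pred s ih =>
    rw [zpow_sub_one₀ hT, ← ih, eq_mul_inv_iff_mul_eq₀ hT, ← map_mul, ← T_add, sub_add_cancel]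

variable {v} [v.IsTrivialOn K] (hT : 1 < v (T 1))

include hT

theorem valuation_eq_zpow_of_posDeg_eq {a : K[T;T⁻¹]} {d : ℤ} (hd : posDeg a = d) :
    v a = v (T 1) ^ d := by
  obtain ⟨hd0, hmax⟩ := coeff_ne_zero_and_le_of_posDeg_eq hd
  have hterm (s : ℤ) (hs : a.coeff s ≠ 0) :
      v (AddMonoidAlgebra.single s (a.coeff s)) = v (T 1) ^ s := by
    rw [single_eq_C_mul_T, map_mul, LaurentPolynomial.C_eq_algebraMap,
      Valuation.IsTrivialOn.eq_one _ hs, one_mul, valuation_T]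
  rw [← hterm d hd0]
  conv_lhs => rw [← AddMonoidAlgebra.sum_coeff_single a]
  refine v.map_sum_eq_of_lt (Finsupp.mem_support_iff.2 hd0) fun s hs => ?_
  rw [Finset.mem_sdiff, Finsupp.mem_support_iff, Finset.mem_singleton] at hs
  rw [hterm s hs.1, hterm d hd0]
  exact zpow_lt_zpow_right₀ hT ((hmax s hs.1).lt_of_ne hs.2)

theorem posDeg_lt_posDeg_of_valuation_lt {a b : K[T;T⁻¹]} (h : v a < v b) :
    posDeg a < posDeg b := by
  have hb : b ≠ 0 := by
    rintro rfl
    exact not_lt_zero (map_zero v ▸ h)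
  obtain ⟨e, he⟩ := exists_posDeg_eq hb
  rcases eq_or_ne a 0 with rfl | ha
  · rw [he]
    exact posDeg_zero (R := K) ▸ WithBot.bot_lt_coe e
  · obtain ⟨d, hd⟩ := exists_posDeg_eq ha
    rw [valuation_eq_zpow_of_posDeg_eq hT hd, valuation_eq_zpow_of_posDeg_eq hT he,
      zpow_lt_zpow_iff_right₀ hT] at h
    rw [hd, he]
    exact_mod_cast h

end DegreeValuation

theorem not_isIntegral_T_one (K : Type*) [CommRing K] [Nontrivial K] :
    ¬ IsIntegral K (T 1 : K[T;T⁻¹]) := by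
  rintro ⟨P, hP, hroot⟩
  refine hP.ne_zero (toLaurent_injective ?_)
  have heval := aeval_algHom_apply (toLaurentAlg (R := K)) X P
  rw [aeval_X_left_apply, toLaurentAlg_apply, toLaurentAlg_apply, toLaurent_X] at heval
  rw [map_zero, ← heval]
  exact hroot

theorem exists_valuationSubring_one_lt {K L : Type*} [Field K] [Field L] [Algebra K L] {x : L}
    (hx : ¬ IsIntegral K x) :
    ∃ O : ValuationSubring L, O.valuation.IsTrivialOn K ∧ 1 < O.valuation x := by
  by_contra! hO
  have htrivial (O : ValuationSubring L) (hK : ((algebraMap K L).range : Set L) ⊆ O.toSubring) :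
      O.valuation.IsTrivialOn K := by
    have hle (a : K) : O.valuation (algebraMap K L a) ≤ 1 :=
      (O.valuation_le_one_iff _).2 (hK ⟨a, rfl⟩)
    refine ⟨fun a ha => (hle a).antisymm ?_⟩
    have hinv := hle a⁻¹
    rw [map_inv₀, map_inv₀] at hinv
    exact (inv_le_one₀ (zero_lt_iff.2 (by simpa using ha))).1 hinv
  have hmem : x ∈ (integralClosure (Subring.closure ((algebraMap K L).range : Set L)) L).toSubring
      := by
    rw [← iInf_valuationSubring_superset, Subring.mem_iInf]
    exact fun O => (O.1.valuation_le_one_iff x).1 (hO O.1 (htrivial O.1 O.2))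
  rw [Subring.closure_eq] at hmem
  obtain ⟨P, hP, hroot⟩ : IsIntegral (algebraMap K L).range x := hmem
  obtain ⟨Q, rfl, -, hQ⟩ := lifts_and_natDegree_eq_and_monic
    (map_surjective _ (algebraMap K L).rangeRestrict_surjective P) hP
  exact hx ⟨Q, hQ, by rwa [eval₂_map] at hroot⟩

theorem valuation_coeff_lt_coeff_zero_of_one_lt {L Γ : Type*} [CommRing L] [Nontrivial L]
    [LinearOrderedCommGroupWithZero Γ] (v : Valuation L Γ) {s : Multiset L}
    (hs : ∀ x ∈ s, 1 < v x) {i : ℕ} (hi : i ≠ 0) :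
    v ((s.map fun x => X - Polynomial.C x).prod.coeff i) <
      v ((s.map fun x => X - Polynomial.C x).prod.coeff 0) := by
  induction s using Multiset.induction_on generalizing i with
  | empty => simp [coeff_one, hi]
  | cons x s ih =>
    replace ih {i : ℕ} := ih (i := i) fun y hy => hs y (Multiset.mem_cons_of_mem hy)
    have hx := hs x (Multiset.mem_cons_self x s)
    rw [Multiset.map_cons, Multiset.prod_cons]
    set q := (s.map fun x => X - Polynomial.C x).prod
    have hq : 0 < v (q.coeff 0) := zero_le.trans_lt (ih one_ne_zero)
    have hle (i : ℕ) : v (q.coeff i) ≤ v (q.coeff 0) := by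
      rcases eq_or_ne i 0 with rfl | hi
      exacts [le_rfl, (ih hi).le]
    obtain ⟨i, rfl⟩ := Nat.exists_eq_succ_of_ne_zero hi
    rw [sub_mul, coeff_sub, coeff_sub, coeff_X_mul, coeff_C_mul, coeff_C_mul, mul_coeff_zero,
      coeff_X_zero, zero_mul, zero_sub, Valuation.map_neg, map_mul]
    refine v.map_sub_lt ((hle i).trans_lt (lt_mul_of_one_lt_left hq hx)) ?_
    rw [map_mul]
    exact mul_lt_mul_of_pos_left (ih i.succ_ne_zero) (zero_lt_one.trans hx)

section Pairing

variable {R M ι : Type*} [CommRing R] [AddCommGroup M] [Module R M] [Fintype ι]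

/-- The pairing of a configuration with a Laurent vector, which sends `T s` times the `k`-th unit
vector to the `k`-th entry of the cell `-s`. -/
def pairing (c : ℤ → ι → M) : (ι → R[T;T⁻¹]) →ₗ[R] M :=
  ∑ k, LinearMap.proj 0 ∘ₗ LinearMap.applyₗ (fun s => c s k) ∘ₗ
    (laurentAction R M).toLinearMap ∘ₗ LinearMap.proj k

theorem pairing_apply (c : ℤ → ι → M) (f : ι → R[T;T⁻¹]) :
    pairing c f = ∑ k, laurentAction R M (f k) (fun s => c s k) 0 := by
  simp [pairing]

variable [DecidableEq ι]

theorem pairing_single_T (c : ℤ → ι → M) (k : ι) (s : ℤ) :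
    pairing c (Pi.single k (T s : R[T;T⁻¹])) = c (-s) k := by
  rw [pairing_apply, Finset.sum_eq_single k (fun i _ hi => by simp [hi]) (by simp),
    Pi.single_eq_same, laurentAction_T, shift_apply, zero_sub]

theorem pairing_vecMul (c : ℤ → ι → M) (f : ι → R[T;T⁻¹]) (A : Matrix ι ι R[T;T⁻¹]) :
    pairing c (Matrix.vecMul f A) = pairing (matrixAction R M A c) f := by
  simp only [pairing_apply, Matrix.vecMul, dotProduct, map_sum, map_mul, LinearMap.sum_apply,
    Finset.sum_apply, Module.End.mul_apply]
  rw [Finset.sum_comm]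
  refine Finset.sum_congr rfl fun i _ => ?_
  rw [matrixAction_row, map_sum, Finset.sum_apply]

omit [DecidableEq ι] in
theorem exists_eq_pairing (φ : (ι → R[T;T⁻¹]) →ₗ[R] M) :
    ∃ c : ℤ → ι → M, φ = pairing c := by
  classical
  refine ⟨fun s k => φ (Pi.single k (T (-s))),
    LinearMap.pi_ext' fun k => AddMonoidAlgebra.lhom_ext' fun s => LinearMap.ext_ring ?_⟩
  exact ((pairing_single_T (fun s k => φ (Pi.single k (T (-s)))) k s).trans
    (by rw [neg_neg]; rfl)).symm

end Pairing

section PositivelyExpansiveOverField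

variable {K ι : Type*} [Field K] [Fintype ι] [DecidableEq ι] {A : Matrix ι ι K[T;T⁻¹]} {N : ℕ}

theorem span_vecMul_pow_eq_top (hN : invisible (matrixAction K K A) N = ⊥) :
    Submodule.span K {f | ∃ (l : ℕ) (s : ℤ) (k : ι), s.natAbs ≤ N ∧
      f = Matrix.vecMul (Pi.single k (T s)) (A ^ l)} = ⊤ := by
  by_contra hne
  obtain ⟨φ, hφ, hle⟩ := Submodule.exists_le_ker_of_lt_top _ (lt_top_iff_ne_top.2 hne)
  obtain ⟨c, rfl⟩ := exists_eq_pairing φ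
  have hc : c = 0 := (Submodule.eq_bot_iff _).1 hN c fun l j hj => funext fun k => by
    have hker := hle (Submodule.subset_span ⟨l, -j, k, by rwa [Int.natAbs_neg], rfl⟩)
    rwa [LinearMap.mem_ker, pairing_vecMul, pairing_single_T, neg_neg, map_pow] at hker
  subst hc
  exact hφ (LinearMap.ext fun f => by simp [pairing_apply, ← Pi.zero_def])

theorem dotProduct_map_vecMul_pow {R S : Type*} [CommRing R] [CommRing S] (φ : R →+* S)
    {A : Matrix ι ι R} {w : ι → S} {x : S} (hw : Matrix.mulVec (A.map φ) w = x • w) (l : ℕ)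
    (f : ι → R) :
    (φ ∘ Matrix.vecMul f (A ^ l)) ⬝ᵥ w = x ^ l * ((φ ∘ f) ⬝ᵥ w) := by
  induction l with
  | zero => simp
  | succ l ih =>
    have hstep (g : ι → R) : (φ ∘ Matrix.vecMul g A) ⬝ᵥ w = x * ((φ ∘ g) ⬝ᵥ w) := by
      have hcomp : φ ∘ Matrix.vecMul g A = Matrix.vecMul (φ ∘ g) (A.map φ) :=
        funext (φ.map_vecMul A g)
      rw [hcomp, ← Matrix.dotProduct_mulVec, hw, dotProduct_smul, smul_eq_mul]
    rw [pow_succ, ← Matrix.vecMul_vecMul, hstep, ih, pow_succ']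
    ring

variable {L Γ : Type*} [Field L] [Algebra K L] [Algebra K[T;T⁻¹] L] [IsScalarTower K K[T;T⁻¹] L]
  [LinearOrderedCommGroupWithZero Γ] {v : Valuation L Γ} [v.IsTrivialOn K]

omit [DecidableEq ι] in
theorem valuation_dotProduct_le_of_mem_span {s : Set (ι → K[T;T⁻¹])} {w : ι → L} {γ : Γ}
    (hs : ∀ f ∈ s, v ((algebraMap K[T;T⁻¹] L ∘ f) ⬝ᵥ w) ≤ γ) {f : ι → K[T;T⁻¹]}
    (hf : f ∈ Submodule.span K s) : v ((algebraMap K[T;T⁻¹] L ∘ f) ⬝ᵥ w) ≤ γ := by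
  induction hf using Submodule.span_induction with
  | mem f hf => exact hs f hf
  | zero => simp [dotProduct]
  | add f g _ _ hf hg =>
    have hadd : algebraMap K[T;T⁻¹] L ∘ (f + g) =
        algebraMap K[T;T⁻¹] L ∘ f + algebraMap K[T;T⁻¹] L ∘ g := funext fun _ => map_add _ _ _
    rw [hadd, add_dotProduct]
    exact v.map_add_le hf hg
  | smul a f _ hf =>
    have hsmul : algebraMap K[T;T⁻¹] L ∘ (a • f) =
        algebraMap K L a • (algebraMap K[T;T⁻¹] L ∘ f) := funext fun _ => by
      rw [Function.comp_apply, Pi.smul_apply, Algebra.smul_def, map_mul,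
        ← IsScalarTower.algebraMap_apply, Pi.smul_apply, smul_eq_mul, Function.comp_apply]
    rw [hsmul, smul_dotProduct, smul_eq_mul, map_mul]
    exact (mul_le_of_le_one_left' (Valuation.IsTrivialOn.valuation_algebraMap_le_one v a)).trans hf

theorem one_lt_valuation_of_isRoot_charpoly (hN : invisible (matrixAction K K A) N = ⊥)
    (hT : 1 < v (algebraMap K[T;T⁻¹] L (T 1))) {x : L}
    (hx : (A.map (algebraMap K[T;T⁻¹] L)).charpoly.IsRoot x) : 1 < v x := by
  rw [IsRoot, Matrix.eval_charpoly, ← Matrix.exists_mulVec_eq_zero_iff] at hx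
  obtain ⟨w, hw0, hw⟩ := hx
  rw [Matrix.sub_mulVec, sub_eq_zero, Matrix.scalar_apply, ← Matrix.smul_one_eq_diagonal,
    Matrix.smul_mulVec, Matrix.one_mulVec] at hw
  set u := v (algebraMap K[T;T⁻¹] L (T 1))
  have hsingle (k : ι) (s : ℤ) :
      v ((algebraMap K[T;T⁻¹] L ∘ Pi.single k (T s)) ⬝ᵥ w) = u ^ s * v (w k) := by
    have hcomp : algebraMap K[T;T⁻¹] L ∘ Pi.single k (T s) =
        Pi.single k (algebraMap K[T;T⁻¹] L (T s)) :=
      funext (Pi.apply_single (fun _ => algebraMap K[T;T⁻¹] L) (fun _ => map_zero _) k (T s))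
    rw [hcomp, single_dotProduct, map_mul]
    exact congrArg (· * v (w k)) (valuation_T (v.comap (algebraMap K[T;T⁻¹] L)) s)
  obtain ⟨k, hk⟩ := Function.ne_iff.1 hw0
  have : Nonempty ι := ⟨k⟩
  obtain ⟨kmax, hmax⟩ := Finite.exists_max fun k => v (w k)
  have hpos : 0 < v (w kmax) := (zero_lt_iff.2 ((v.ne_zero_iff).2 hk)).trans_le (hmax k)
  -- Otherwise pairing with `w` is bounded on the spanning vectors, but not on the powers of `T`.
  by_contra! hle
  have hbound (f : ι → K[T;T⁻¹]) :
      v ((algebraMap K[T;T⁻¹] L ∘ f) ⬝ᵥ w) ≤ u ^ (N : ℤ) * v (w kmax) := by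
    refine valuation_dotProduct_le_of_mem_span ?_ (span_vecMul_pow_eq_top hN ▸ Submodule.mem_top)
    rintro f ⟨l, s, k, hs, rfl⟩
    rw [dotProduct_map_vecMul_pow _ hw.symm, map_mul, hsingle, map_pow]
    exact (mul_le_of_le_one_left' (pow_le_one' hle l)).trans
      (mul_le_mul' (zpow_le_zpow_right₀ hT.le (by omega)) (hmax k))
  have hlarge := hbound (Pi.single kmax (T (N + 1)))
  rw [hsingle] at hlarge
  exact hlarge.not_gt (mul_lt_mul_of_pos_right (zpow_lt_zpow_right₀ hT (by omega)) hpos)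

theorem topDominates_charpoly_of_invisible_eq_bot (hN : invisible (matrixAction K K A) N = ⊥) :
    TopDominates A.charpoly := by
  let L := AlgebraicClosure (FractionRing K[T;T⁻¹])
  have hinj : Function.Injective (algebraMap K[T;T⁻¹] L) := by
    rw [IsScalarTower.algebraMap_eq K[T;T⁻¹] (FractionRing K[T;T⁻¹]) L]
    exact (algebraMap (FractionRing K[T;T⁻¹]) L).injective.comp (IsFractionRing.injective _ _)
  obtain ⟨O, hO, hT⟩ := exists_valuationSubring_one_lt (K := K)
    (x := algebraMap K[T;T⁻¹] L (T 1)) fun h =>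
      not_isIntegral_T_one K ((isIntegral_algebraMap_iff hinj).1 h)
  have : (O.valuation.comap (algebraMap K[T;T⁻¹] L)).IsTrivialOn K := ⟨fun a ha => by
    rw [Valuation.comap_apply, ← IsScalarTower.algebraMap_apply, hO.eq_one a ha]⟩
  intro i hi
  refine posDeg_lt_posDeg_of_valuation_lt (v := O.valuation.comap (algebraMap K[T;T⁻¹] L)) hT ?_
  have hroots := valuation_coeff_lt_coeff_zero_of_one_lt O.valuation (fun x hx =>
    one_lt_valuation_of_isRoot_charpoly hN hT (isRoot_of_mem_roots hx)) hi
  rwa [← (IsAlgClosed.splits _).eq_prod_roots_of_monic (Matrix.charpoly_monic _),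
    Matrix.charpoly_map, coeff_map, coeff_map] at hroots

variable [Nonempty ι]

theorem expansivePoly_charpoly_of_invisible_eq_bot (hN : invisible (matrixAction K K A) N = ⊥) :
    ExpansivePoly A.charpoly := by
  refine (expansivePoly_charpoly_iff A).2 ⟨topDominates_charpoly_of_invisible_eq_bot hN,
    topDominates_charpoly_of_invisible_eq_bot (N := N) ?_⟩
  refine (Submodule.eq_bot_iff _).2 fun c hc => ?_
  have hmirror : (fun s => c (-s)) = 0 := (Submodule.eq_bot_iff _).1 hN _ fun l j hj => by
    rw [← neg_neg j, ← matrixAction_invert_pow]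
    simpa only [neg_neg] using hc l (-j) (by rwa [Int.natAbs_neg])
  exact funext fun j => by simpa using congrFun hmirror (-j)

variable (A) in
theorem positivelyExpansive_matrixAction_iff_expansivePoly_charpoly :
    PositivelyExpansive (matrixAction K K A) ↔ ExpansivePoly A.charpoly := by
  obtain ⟨r, hr⟩ := exists_hasRadius A
  rw [positivelyExpansive_iff_exists_invisible_eq_bot]
  exact ⟨fun ⟨_, hN⟩ => expansivePoly_charpoly_of_invisible_eq_bot hN, fun hA =>
    ⟨_, (hr.windowGrows_of_expansivePoly_charpoly hA).invisible_eq_bot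
      (commute_matrixAction_shift A)⟩⟩

theorem HasRadius.windowGrows_iff_expansivePoly_charpoly {r : ℕ} (hr : HasRadius r A) :
    WindowGrows (matrixAction K K A) (Fintype.card ι * r) (Fintype.card ι) ↔
      ExpansivePoly A.charpoly :=
  ⟨fun h => expansivePoly_charpoly_of_invisible_eq_bot
    (h.invisible_eq_bot (commute_matrixAction_shift A)), hr.windowGrows_of_expansivePoly_charpoly⟩

end PositivelyExpansiveOverField

section ReductionModuloMaximalIdeals

variable {R M ι : Type*} [CommRing R] [AddCommGroup M] [Module R M] [Fintype ι] [DecidableEq ι]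
  {A : Matrix ι ι R[T;T⁻¹]} {N : ℕ}

theorem invisible_eq_bot_of_forall_separating {M' : Type*} [AddCommGroup M'] [Module R M']
    (h : ∀ x : M, x ≠ 0 → ∃ φ : M →ₗ[R] M', φ x ≠ 0)
    (hN : invisible (matrixAction R M' A) N = ⊥) : invisible (matrixAction R M A) N = ⊥ := by
  refine (Submodule.eq_bot_iff _).2 fun c hc => funext fun j => funext fun i => ?_
  by_contra hne
  obtain ⟨φ, hφ⟩ := h _ hne
  have hzero := (Submodule.eq_bot_iff _).1 hN _ (comp_mem_invisible φ hc)
  exact hφ (congrFun (congrFun hzero j) i)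

theorem exists_injective_quotient_linearMap [IsArtinianRing R] (𝔪 : Ideal R) [𝔪.IsMaximal] :
    ∃ φ : (R ⧸ 𝔪) →ₗ[R] R, Function.Injective φ := by
  -- A maximal ideal of an Artinian ring is a minimal prime, hence an associated prime of the ring.
  have hbot : (⊥ : Ideal R) ≤ 𝔪 := bot_le
  obtain ⟨𝔭, h𝔭, hle⟩ := Ideal.exists_minimalPrimes_le hbot
  have : 𝔭.IsPrime := h𝔭.1.1
  obtain rfl := (IsArtinianRing.isMaximal_of_isPrime 𝔭).eq_of_le Ideal.IsPrime.ne_top' hle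
  rw [← Module.annihilator_eq_bot.2 (inferInstance : FaithfulSMul R R)] at h𝔭
  exact (isAssociatedPrime_iff_exists_injective_linearMap _ _).1
    (Module.associatedPrimes.minimalPrimes_annihilator_subset_associatedPrimes R R h𝔭) |>.2

theorem exists_quotient_linearMap_ne_zero (𝔪 : Ideal R) [𝔪.IsMaximal]
    (x : Submodule.torsionBySet R M 𝔪) (hx : x ≠ 0) :
    ∃ φ : Submodule.torsionBySet R M 𝔪 →ₗ[R] R ⧸ 𝔪, φ x ≠ 0 := by
  let := Ideal.Quotient.field 𝔪
  obtain ⟨φ, hφ⟩ := Module.Projective.exists_dual_ne_zero (R ⧸ 𝔪) hx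
  exact ⟨φ.restrictScalars R, hφ⟩

theorem invisible_eq_bot_of_forall_quotient [IsArtinianRing R]
    (hN : ∀ 𝔪 : MaximalSpectrum R, invisible (matrixAction R (R ⧸ 𝔪.asIdeal) A) N = ⊥) :
    invisible (matrixAction R M A) N = ⊥ := by
  by_contra hne
  have := Submodule.nontrivial_iff_ne_bot.2 hne
  obtain ⟨𝔪, h𝔪⟩ := associatedPrimes.nonempty R (invisible (matrixAction R M A) N)
  obtain ⟨hprime, ⟨c, hc⟩, hann⟩ := isAssociatedPrime_iff.1 h𝔪
  have hmem (a : R) : a ∈ 𝔪 ↔ a • c = 0 := by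
    rw [hann, Submodule.mem_colon_singleton, Submodule.mem_bot, Subtype.ext_iff]
    rfl
  have hmax := IsArtinianRing.isMaximal_of_isPrime 𝔪
  have htorsion (j : ℤ) (i : ι) : c j i ∈ Submodule.torsionBySet R M 𝔪 :=
    (Submodule.mem_torsionBySet_iff _ _).2 fun a =>
      congrFun (congrFun ((hmem a).1 a.2) j) i
  have hbot := invisible_eq_bot_of_forall_separating
    (exists_quotient_linearMap_ne_zero (M := M) 𝔪) (hN ⟨𝔪, hmax⟩)
  have hzero := (Submodule.eq_bot_iff _).1 hbot (fun j i => ⟨c j i, htorsion j i⟩)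
    (mem_invisible_of_comp (Submodule.torsionBySet R M 𝔪).subtype_injective hc)
  have hc0 : c = 0 := funext fun j => funext fun i =>
    congrArg Subtype.val (congrFun (congrFun hzero j) i)
  exact hprime.ne_top ((Ideal.eq_top_iff_one _).2 ((hmem 1).2 (by rw [hc0, smul_zero])))

theorem positivelyExpansive_matrixAction_iff_forall_quotient [IsArtinianRing R] :
    PositivelyExpansive (matrixAction R R A) ↔
      ∀ 𝔪 : MaximalSpectrum R, PositivelyExpansive (matrixAction R (R ⧸ 𝔪.asIdeal) A) := by
  simp only [positivelyExpansive_iff_exists_invisible_eq_bot]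
  constructor
  · rintro ⟨N, hN⟩ 𝔪
    obtain ⟨φ, hφ⟩ := exists_injective_quotient_linearMap 𝔪.asIdeal
    exact ⟨N, invisible_eq_bot_of_forall_separating
      (fun x hx => ⟨φ, (map_ne_zero_iff φ hφ).2 hx⟩) hN⟩
  · intro h
    choose N hN using h
    obtain ⟨B, hB⟩ := (Set.finite_range N).bddAbove
    exact ⟨B, invisible_eq_bot_of_forall_quotient fun 𝔪 =>
      le_bot_iff.1 ((invisible_antitone _ (hB ⟨𝔪, rfl⟩)).trans (hN 𝔪).le)⟩

theorem positivelyExpansive_matrixAction_iff_forall_expansivePoly [IsArtinianRing R] [Nonempty ι]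
    (A : Matrix ι ι R[T;T⁻¹]) :
    PositivelyExpansive (matrixAction R R A) ↔ ∀ 𝔪 : MaximalSpectrum R, ExpansivePoly
      ((AddMonoidAlgebra.mapRingHom ℤ (Ideal.Quotient.mk 𝔪.asIdeal)).mapMatrix A).charpoly := by
  refine positivelyExpansive_matrixAction_iff_forall_quotient.trans (forall_congr' fun 𝔪 => ?_)
  let := Ideal.Quotient.field 𝔪.asIdeal
  rw [← positivelyExpansive_matrixAction_iff_expansivePoly_charpoly]
  exact iff_of_eq (congrArg PositivelyExpansive (funext fun c =>
    (matrixAction_baseChange (S := R ⧸ 𝔪.asIdeal) A c).symm))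

end ReductionModuloMaximalIdeals

theorem expansivePoly_charpoly_map_comp_iff {R S S' ι : Type*} [CommRing R] [CommRing S]
    [CommRing S'] [Fintype ι] [DecidableEq ι] (g : R →+* S) {f : S →+* S'}
    (hf : Function.Injective f) (A : Matrix ι ι R[T;T⁻¹]) :
    ExpansivePoly ((AddMonoidAlgebra.mapRingHom ℤ (f.comp g)).mapMatrix A).charpoly ↔
      ExpansivePoly ((AddMonoidAlgebra.mapRingHom ℤ g).mapMatrix A).charpoly := by
  rw [← expansivePoly_map_iff hf, ← Matrix.charpoly_map, AddMonoidAlgebra.mapRingHom_comp]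
  rfl

theorem LinearRule.positivelyExpansive_iff_forall_expansiveMatrix {m n : ℕ} [NeZero m] [NeZero n]
    (A : LinearRule m n) : PositivelyExpansive A.automaton ↔
      ∀ (p : ℕ) (_ : p.Prime) (h : p ∣ m), ExpansiveMatrix (reduceMod h A.assocMatrix) := by
  rw [A.automaton_eq_matrixAction, positivelyExpansive_matrixAction_iff_forall_expansivePoly]
  constructor
  · intro h p hp hpm
    have := Fact.mk hp
    let φ := ZMod.castHom hpm (ZMod p)
    have hφ := RingHom.ker_isMaximal_of_surjective φ (ZMod.castHom_surjective hpm)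
    exact (expansivePoly_charpoly_map_comp_iff (Ideal.Quotient.mk (RingHom.ker φ))
      (RingHom.kerLift_injective φ) A.assocMatrix).2 (h ⟨_, hφ⟩)
  · intro h 𝔪
    let := Ideal.Quotient.field 𝔪.asIdeal
    obtain ⟨p, hp⟩ := CharP.exists (ZMod m ⧸ 𝔪.asIdeal)
    have hpm : p ∣ m := (CharP.cast_eq_zero_iff (ZMod m ⧸ 𝔪.asIdeal) p m).1 (by
      rw [← map_natCast (Ideal.Quotient.mk 𝔪.asIdeal), ZMod.natCast_self, map_zero])
    have : NeZero p := ⟨ne_zero_of_dvd_ne_zero (NeZero.ne m) hpm⟩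
    have hprime : p.Prime := (CharP.char_is_prime_of_pos (ZMod m ⧸ 𝔪.asIdeal) p).out
    have hexp := (expansivePoly_charpoly_map_comp_iff (ZMod.castHom hpm (ZMod p))
      (ZMod.castHom_injective (n := p) (ZMod m ⧸ 𝔪.asIdeal)) A.assocMatrix).2 (h p hprime hpm)
    rwa [Subsingleton.elim ((ZMod.castHom _ _).comp _) (Ideal.Quotient.mk 𝔪.asIdeal)] at hexp

section SpaceTime

/-- The matrix over `ℤ/pℤ` of the automaton of radius `r` on `n` components whose coefficient of
component `j` at offset `z - r`, in the rule for component `k`, is the residue of `E z k j`. -/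
def stencilMatrix (p n r : ℕ) (E : ℕ → ℕ → ℕ → ℕ) : Matrix (Fin n) (Fin n) (ZMod p)[T;T⁻¹] :=
  Matrix.of fun k j => ∑ z ∈ Finset.range (2 * r + 1),
    LaurentPolynomial.C (E z k j : ZMod p) * T (-((z : ℤ) - r))

/-- The value at component `k` after one step of the automaton of `stencilMatrix p n r E`, computed
in `{0, …, p - 1}` from the row `u`, whose cells are read from position `i` to position
`i + 2 * r`. -/
def stencilStep (p n r : ℕ) (E : ℕ → ℕ → ℕ → ℕ) (u : ℕ → ℕ → ℕ) (i k : ℕ) : ℕ :=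
  (∑ z ∈ Finset.range (2 * r + 1), ∑ j ∈ Finset.range n, E z k j * u (i + z) j) % p

/-- The array `u`, indexed by time, position and component, is a piece of a space-time diagram with
`L` steps and `4 * N + 3` cells. Position `i` stands for the cell `i - (2 * N + 1)`. -/
def Evolves (p n r L N : ℕ) (E u : ℕ → ℕ → ℕ → ℕ) : Prop :=
  ∀ l < L, ∀ i < 4 * N + 3 - 2 * r, ∀ k < n,
    u (l + 1) (i + r) k = stencilStep p n r E (u l) i k

/-- The array vanishes on the cells `-N, …, N` up to time `L`. -/
def VanishesOnWindow (n L N : ℕ) (u : ℕ → ℕ → ℕ → ℕ) : Prop :=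
  ∀ l < L + 1, ∀ i < 2 * N + 1, ∀ k < n, u l (i + (N + 1)) k = 0

/-- The array vanishes on the cells `N + 1` and `-(N + 1)` at time `0`. -/
def VanishesOnBorder (n N : ℕ) (u : ℕ → ℕ → ℕ → ℕ) : Prop :=
  ∀ k < n, u 0 (3 * N + 2) k = 0 ∧ u 0 N k = 0

/-- The array of digits of `x` in base `p`. -/
def digitArray (p x l i k : ℕ) : ℕ := x / p ^ Nat.pair l (Nat.pair i k) % p

/-- A number of digits that suffices for an array with `L + 1` rows, `4 * N + 3` cells and `n`
components. -/
def digitBound (n L N : ℕ) : ℕ := Nat.pair (L + 1) (Nat.pair (4 * N + 3) n)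

/-- The property `WindowGrows` of the automaton of `stencilMatrix p n r E`, as a formula with
bounded quantifiers: all space-time diagrams that matter are coded by small numbers. -/
def DiagramCheck (p n r L N : ℕ) (E : ℕ → ℕ → ℕ → ℕ) : Prop :=
  ∀ x < p ^ digitBound n L N, Evolves p n r L N E (digitArray p x) →
    VanishesOnWindow n L N (digitArray p x) → VanishesOnBorder n N (digitArray p x)

variable {p n r L N : ℕ} {E u : ℕ → ℕ → ℕ → ℕ}

theorem exists_digitArray [NeZero p] (n L N : ℕ) (hu : ∀ l i k, u l i k < p) :
    ∃ x < p ^ digitBound n L N,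
      ∀ l < L + 1, ∀ i < 4 * N + 3, ∀ k < n, digitArray p x l i k = u l i k := by
  let digits : Fin (digitBound n L N) → Fin p := fun d =>
    ⟨u (d : ℕ).unpair.1 (d : ℕ).unpair.2.unpair.1 (d : ℕ).unpair.2.unpair.2, hu _ _ _⟩
  refine ⟨finFunctionFinEquiv digits, (finFunctionFinEquiv digits).2, fun l hl i hi k hk => ?_⟩
  have hlt : Nat.pair l (Nat.pair i k) < digitBound n L N :=
    (Nat.pair_lt_pair_left _ hl).trans (Nat.pair_lt_pair_right _
      ((Nat.pair_lt_pair_left _ hi).trans (Nat.pair_lt_pair_right _ hk)))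
  have hdigit := congrFun (finFunctionFinEquiv.symm_apply_apply digits) ⟨_, hlt⟩
  exact (congrArg Fin.val hdigit).trans (by simp only [digits, Nat.unpair_pair])

theorem hasRadius_stencilMatrix (p n r : ℕ) (E : ℕ → ℕ → ℕ → ℕ) :
    HasRadius r (stencilMatrix p n r E) := by
  intro i k s hs
  contrapose! hs
  simp only [stencilMatrix, Matrix.of_apply, ← single_eq_C_mul_T, AddMonoidAlgebra.coeff_sum,
    Finsupp.finsetSum_apply, AddMonoidAlgebra.coeff_single]
  refine Finset.sum_eq_zero fun z hz => Finsupp.single_eq_of_ne ?_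
  have := Finset.mem_range.1 hz
  omega

theorem matrixAction_stencilMatrix_apply (c : ℤ → Fin n → ZMod p) (y : ℤ) (k : Fin n) :
    matrixAction (ZMod p) (ZMod p) (stencilMatrix p n r E) c y k =
      ∑ z ∈ Finset.range (2 * r + 1), ∑ j : Fin n, (E z k j : ZMod p) * c (y + (z - r)) j := by
  simp only [matrixAction_apply, stencilMatrix, Matrix.of_apply, map_sum, LinearMap.sum_apply,
    Finset.sum_apply, laurentAction_C_mul_T, smul_eq_mul, sub_neg_eq_add]
  exact Finset.sum_comm

theorem matrixAction_stencilMatrix_eq_stencilStep {v : ℕ → ℕ → ℕ} {c : ℤ → Fin n → ZMod p} {y : ℤ}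
    {i : ℕ} (hv : ∀ z < 2 * r + 1, ∀ j : Fin n, c (y + (z - r)) j = v (i + z) j) (k : Fin n) :
    matrixAction (ZMod p) (ZMod p) (stencilMatrix p n r E) c y k = stencilStep p n r E v i k := by
  rw [matrixAction_stencilMatrix_apply, stencilStep, ZMod.natCast_mod, Nat.cast_sum]
  refine Finset.sum_congr rfl fun z hz => ?_
  rw [Nat.cast_sum, Finset.sum_range]
  exact Finset.sum_congr rfl fun j _ => by rw [hv z (Finset.mem_range.1 hz), Nat.cast_mul]

theorem Evolves.matrixAction_pow_apply (hu : Evolves p n r L N E u) {c : ℤ → Fin n → ZMod p}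
    (hc : ∀ i : ℕ, i < 4 * N + 3 → ∀ k : Fin n, c (i - (2 * N + 1)) k = u 0 i k) {l : ℕ}
    (hl : l ≤ L) {i : ℕ} (hleft : l * r ≤ i) (hright : i + l * r < 4 * N + 3) (k : Fin n) :
    (matrixAction (ZMod p) (ZMod p) (stencilMatrix p n r E) ^ l) c (i - (2 * N + 1)) k =
      u l i k := by
  induction l generalizing i k with
  | zero => exact hc i (by omega) k
  | succ l ih =>
    rw [add_mul, one_mul] at hleft hright
    obtain ⟨i, rfl⟩ := Nat.exists_eq_add_of_le' (show r ≤ i by omega)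
    rw [hu l (by omega) i (by omega) k k.2, pow_succ', Module.End.mul_apply]
    refine matrixAction_stencilMatrix_eq_stencilStep (fun z hz j => ?_) k
    rw [← ih (by omega) (by omega) (by omega) j,
      show ((i + z : ℕ) : ℤ) - (2 * N + 1) = (i + r : ℕ) - (2 * N + 1) + (z - r) by omega]

theorem evolves_of_matrixAction_pow_apply {c : ℤ → Fin n → ZMod p}
    (hup : ∀ l i k, u l i k < p)
    (hu : ∀ l ≤ L, ∀ i : ℕ, i < 4 * N + 3 → ∀ k : Fin n,
      (matrixAction (ZMod p) (ZMod p) (stencilMatrix p n r E) ^ l) c (i - (2 * N + 1)) k =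
        u l i k) :
    Evolves p n r L N E u := by
  intro l hl i hi k hk
  have hstep := matrixAction_stencilMatrix_eq_stencilStep (r := r) (E := E) (v := u l) (i := i)
    (y := ((i + r : ℕ) : ℤ) - (2 * N + 1)) (fun z hz j => by
      rw [← hu l hl.le (i + z) (by omega) j,
        show ((i + z : ℕ) : ℤ) - (2 * N + 1) = (i + r : ℕ) - (2 * N + 1) + (z - r) by omega])
    ⟨k, hk⟩
  rw [← Module.End.mul_apply, ← pow_succ', hu (l + 1) hl (i + r) (by omega) ⟨k, hk⟩,
    ZMod.natCast_eq_natCast_iff', Nat.mod_eq_of_lt (hup _ _ _)] at hstep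
  exact hstep.trans (Nat.mod_mod _ _)

theorem natCast_zmod_eq_zero_iff_of_lt {x : ℕ} (hx : x < p) : (x : ZMod p) = 0 ↔ x = 0 := by
  rw [ZMod.natCast_eq_zero_iff]
  exact ⟨fun h => Nat.eq_zero_of_dvd_of_lt h hx, fun h => h ▸ dvd_zero p⟩

theorem vanishesOnWindow_iff {v : ℕ → ℤ → Fin n → ZMod p} (hup : ∀ l i k, u l i k < p)
    (hv : ∀ l ≤ L, ∀ i : ℕ, N < i → i < 3 * N + 2 → ∀ k : Fin n,
      v l (i - (2 * N + 1)) k = u l i k) :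
    VanishesOnWindow n L N u ↔ ∀ l ≤ L, ∀ j : ℤ, j.natAbs ≤ N → v l j = 0 := by
  constructor
  · intro hwin l hl j hj
    funext k
    obtain ⟨i, hi⟩ := Int.eq_ofNat_of_zero_le (show 0 ≤ j + N by omega)
    obtain rfl : j = ((i + (N + 1) : ℕ) : ℤ) - (2 * N + 1) := by push_cast; omega
    rw [hv l hl _ (by omega) (by omega), hwin l (by omega) i (by omega) k k.2, Nat.cast_zero,
      Pi.zero_apply]
  · intro hzero l hl i hi k hk
    rw [← natCast_zmod_eq_zero_iff_of_lt (hup _ _ _),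
      ← hv l (by omega) _ (by omega) (by omega) ⟨k, hk⟩, hzero l (by omega) _ (by omega),
      Pi.zero_apply]

theorem vanishesOnBorder_iff {c : ℤ → Fin n → ZMod p} (hup : ∀ l i k, u l i k < p)
    (hc : ∀ i : ℕ, i < 4 * N + 3 → ∀ k : Fin n, c (i - (2 * N + 1)) k = u 0 i k) :
    VanishesOnBorder n N u ↔ c (N + 1) = 0 ∧ c (-(N + 1)) = 0 := by
  have hright : (N : ℤ) + 1 = (3 * N + 2 : ℕ) - (2 * N + 1) := by push_cast; ring
  have hleft : -((N : ℤ) + 1) = N - (2 * N + 1) := by ring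
  rw [VanishesOnBorder, hleft, hright, funext_iff, funext_iff, ← forall_and, Fin.forall_iff]
  refine forall₂_congr fun k hk => ?_
  rw [hc _ (by omega) ⟨k, hk⟩, hc _ (by omega) ⟨k, hk⟩, Pi.zero_apply,
    natCast_zmod_eq_zero_iff_of_lt (hup _ _ _), natCast_zmod_eq_zero_iff_of_lt (hup _ _ _)]

theorem digitArray_lt [NeZero p] (x l i k : ℕ) : digitArray p x l i k < p :=
  Nat.mod_lt _ (NeZero.pos p)

theorem WindowGrows.diagramCheck [NeZero p] (hLN : L * r ≤ N)
    (hW : WindowGrows (matrixAction (ZMod p) (ZMod p) (stencilMatrix p n r E)) N L) :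
    DiagramCheck p n r L N E := by
  intro x _ hev hwin
  let c : ℤ → Fin n → ZMod p := fun y k => digitArray p x 0 (y + (2 * N + 1)).toNat k
  have hc (i : ℕ) (_ : i < 4 * N + 3) (k : Fin n) :
      c (i - (2 * N + 1)) k = digitArray p x 0 i k := by
    simp only [c, sub_add_cancel, Int.toNat_natCast]
  refine (vanishesOnBorder_iff (digitArray_lt x) hc).2
    (hW c ((vanishesOnWindow_iff (digitArray_lt x) fun l hl i hleft hright k => ?_).1 hwin))
  have := Nat.mul_le_mul_right r hl
  exact hev.matrixAction_pow_apply hc hl (by omega) (by omega) k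

theorem DiagramCheck.windowGrows [NeZero p] (hD : DiagramCheck p n r L N E) :
    WindowGrows (matrixAction (ZMod p) (ZMod p) (stencilMatrix p n r E)) N L := by
  intro c hc
  let F := matrixAction (ZMod p) (ZMod p) (stencilMatrix p n r E)
  let orbit : ℕ → ℕ → ℕ → ℕ := fun l i k =>
    if hk : k < n then ((F ^ l) c (i - (2 * N + 1)) ⟨k, hk⟩).val else 0
  obtain ⟨x, hx, hdigit⟩ := exists_digitArray n L N (u := orbit) fun l i k => by
    simp only [orbit]
    split_ifs
    exacts [ZMod.val_lt _, NeZero.pos p]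
  have hcast (l : ℕ) (hl : l ≤ L) (i : ℕ) (hi : i < 4 * N + 3) (k : Fin n) :
      (F ^ l) c (i - (2 * N + 1)) k = digitArray p x l i k := by
    rw [hdigit l (by omega) i hi k k.2]
    simp only [orbit, k.2, dif_pos, ZMod.natCast_val, ZMod.cast_id', id_eq]
  have hwin : VanishesOnWindow n L N (digitArray p x) :=
    (vanishesOnWindow_iff (v := fun l => (F ^ l) c) (digitArray_lt x) fun l hl i _ _ =>
      hcast l hl i (by omega)).2 hc
  exact (vanishesOnBorder_iff (digitArray_lt x) (hcast 0 L.zero_le)).1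
    (hD x hx (evolves_of_matrixAction_pow_apply (digitArray_lt x) hcast) hwin)

theorem expansiveMatrix_stencilMatrix_iff_diagramCheck [Fact p.Prime] [NeZero n] :
    ExpansiveMatrix (stencilMatrix p n r E) ↔ DiagramCheck p n r n (n * r) E := by
  have hgrows := (hasRadius_stencilMatrix p n r E).windowGrows_iff_expansivePoly_charpoly
  rw [Fintype.card_fin] at hgrows
  rw [ExpansiveMatrix, ← hgrows]
  exact ⟨WindowGrows.diagramCheck le_rfl, DiagramCheck.windowGrows⟩

end SpaceTime

section Code

/-- The entries of a list of matrices given by lists of rows; they are `0` out of range. -/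
def listEntry (M : List (List (List ℕ))) (z k j : ℕ) : ℕ :=
  ((M.getD z []).getD k []).getD j 0

/-- The condition on the finite description of a linear cellular automaton which decides its
positive expansivity. -/
def CodeCheck (q : ℕ × ℕ × ℕ × List (List (List ℕ))) : Prop :=
  ∀ p < q.1 + 1, p.Prime → p ∣ q.1 →
    DiagramCheck p q.2.1 q.2.2.1 q.2.1 (q.2.1 * q.2.2.1) (listEntry q.2.2.2)

namespace LinearRule

variable {m n : ℕ} (A : LinearRule m n)

theorem listEntry_code (z : Fin (2 * A.radius + 1)) (k j : Fin n) :
    listEntry A.code.2.2.2 z k j = (A.mat z k j).val := by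
  simp only [listEntry, code, List.getD_eq_getElem?_getD, List.getElem?_ofFn, Fin.is_lt, dif_pos,
    Option.getD_some]

theorem reduceMod_assocMatrix [NeZero m] {p : ℕ} (h : p ∣ m) :
    reduceMod h A.assocMatrix = stencilMatrix p n A.radius (listEntry A.code.2.2.2) := by
  ext1 k j
  simp only [reduceMod, assocMatrix, stencilMatrix, Matrix.map_apply, Matrix.of_apply, map_sum,
    Finset.sum_range, listEntry_code, ZMod.natCast_val, ← single_eq_C_mul_T,
    AddMonoidAlgebra.mapRingHom_single, ZMod.castHom_apply]

theorem codeCheck_code_iff_positivelyExpansive [NeZero m] [NeZero n] :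
    CodeCheck A.code ↔ PositivelyExpansive A.automaton := by
  have hcheck (p : ℕ) (hp : p.Prime) (h : p ∣ m) :
      ExpansiveMatrix (reduceMod h A.assocMatrix) ↔
        DiagramCheck p n A.radius n (n * A.radius) (listEntry A.code.2.2.2) := by
    have : Fact p.Prime := ⟨hp⟩
    rw [A.reduceMod_assocMatrix h, expansiveMatrix_stencilMatrix_iff_diagramCheck]
  rw [A.positivelyExpansive_iff_forall_expansiveMatrix]
  refine forall_congr' fun p => ⟨fun H hp h => ?_, fun H _ hp h => ?_⟩
  · exact (hcheck p hp h).2 (H (Nat.lt_succ_of_le (Nat.le_of_dvd (NeZero.pos m) h)) hp h)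
  · exact (hcheck p hp h).1 (H hp h)

end LinearRule

end Code

section Computability

variable {α : Type*} [Primcodable α]

theorem primrecPred_forall_lt {R : α → ℕ → Prop} {f : α → ℕ} (hf : Primrec f)
    (hR : PrimrecPred fun q : α × ℕ => R q.1 q.2) : PrimrecPred fun a => ∀ x < f a, R a x := by
  have h : PrimrecRel fun (x : ℕ) (a : α) => R a x := hR.comp (Primrec.pair .snd .fst)
  exact (h.forall_mem_list.comp (Primrec.list_range.comp hf) .id).of_eq fun a => by simp

theorem primrecPred_imp {P Q : α → Prop} (hP : PrimrecPred P) (hQ : PrimrecPred Q) :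
    PrimrecPred fun a => P a → Q a :=
  (hP.not.or hQ).of_eq fun _ => imp_iff_not_or.symm

theorem primrec_sum_range {f : α → ℕ → ℕ} {g : α → ℕ} (hg : Primrec g)
    (hf : Primrec fun q : α × ℕ => f q.1 q.2) :
    Primrec fun a => ∑ i ∈ Finset.range (g a), f a i := by
  have hstep : Primrec₂ fun (a : α) (q : ℕ × ℕ) => q.2 + f a q.1 :=
    Primrec.nat_add.comp (Primrec.snd.comp .snd)
      (hf.comp (Primrec.pair .fst (Primrec.fst.comp .snd)))
  refine (Primrec.nat_rec' hg (Primrec.const 0) hstep).of_eq fun a => ?_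
  induction g a with
  | zero => rfl
  | succ k ih => rw [Finset.sum_range_succ, ← ih]

theorem primrec_nat_pow : Primrec₂ ((· ^ ·) : ℕ → ℕ → ℕ) :=
  Primrec₂.unpaired'.1 Nat.Primrec.pow

theorem primrecPred_dvd {f g : α → ℕ} (hf : Primrec f) (hg : Primrec g) :
    PrimrecPred fun a => f a ∣ g a :=
  (Primrec.eq.comp (Primrec.nat_mod.comp hg hf) (Primrec.const 0)).of_eq fun _ =>
    Nat.dvd_iff_mod_eq_zero.symm

theorem primrecPred_prime : PrimrecPred Nat.Prime := by
  have h : PrimrecPred fun p => 2 ≤ p ∧ ∀ x < p, x ∣ p → x = 1 :=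
    (Primrec.nat_le.comp (Primrec.const 2) .id).and (primrecPred_forall_lt .id
      (primrecPred_imp (primrecPred_dvd .snd .fst) (Primrec.eq.comp .snd (Primrec.const 1))))
  exact h.of_eq fun p => Nat.prime_def_lt.symm

section DiagramCheck

variable {p n r L N x l i k : α → ℕ} {M : α → List (List (List ℕ))}

theorem primrec_digitArray (hp : Primrec p) (hx : Primrec x) (hl : Primrec l)
    (hi : Primrec i) (hk : Primrec k) :
    Primrec fun a => digitArray (p a) (x a) (l a) (i a) (k a) :=
  Primrec.nat_mod.comp (Primrec.nat_div.comp hx (primrec_nat_pow.comp hp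
    (Primrec₂.natPair.comp hl (Primrec₂.natPair.comp hi hk)))) hp

theorem primrec_listEntry {z k j : α → ℕ} (hM : Primrec M) (hz : Primrec z) (hk : Primrec k)
    (hj : Primrec j) : Primrec fun a => listEntry (M a) (z a) (k a) (j a) :=
  (Primrec.list_getD 0).comp ((Primrec.list_getD []).comp
    ((Primrec.list_getD []).comp hM hz) hk) hj

theorem primrec_stencilStep (hp : Primrec p) (hn : Primrec n) (hr : Primrec r) (hM : Primrec M)
    (hx : Primrec x) (hl : Primrec l) (hi : Primrec i) (hk : Primrec k) : Primrec fun a =>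
      stencilStep (p a) (n a) (r a) (listEntry (M a)) (digitArray (p a) (x a) (l a)) (i a)
        (k a) := by
  have hrange : Primrec fun a => 2 * r a + 1 :=
    Primrec.succ.comp (Primrec.nat_mul.comp (Primrec.const 2) hr)
  refine Primrec.nat_mod.comp (primrec_sum_range hrange
    (primrec_sum_range (hn.comp .fst) (Primrec.nat_mul.comp ?_ ?_))) hp
  all_goals
    have ha : Primrec fun q : (α × ℕ) × ℕ => q.1.1 := Primrec.fst.comp .fst
    have hz : Primrec fun q : (α × ℕ) × ℕ => q.1.2 := Primrec.snd.comp .fst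
  · exact primrec_listEntry (hM.comp ha) hz (hk.comp ha) .snd
  · exact primrec_digitArray (hp.comp ha) (hx.comp ha) (hl.comp ha)
      (Primrec.nat_add.comp (hi.comp ha) hz) .snd

theorem primrecPred_evolves (hp : Primrec p) (hn : Primrec n) (hr : Primrec r) (hL : Primrec L)
    (hN : Primrec N) (hM : Primrec M) (hx : Primrec x) : PrimrecPred fun a =>
      Evolves (p a) (n a) (r a) (L a) (N a) (listEntry (M a)) (digitArray (p a) (x a)) := by
  have hwidth : Primrec fun a => 4 * N a + 3 - 2 * r a :=
    Primrec.nat_sub.comp (Primrec.nat_add.comp (Primrec.nat_mul.comp (Primrec.const 4) hN)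
      (Primrec.const 3)) (Primrec.nat_mul.comp (Primrec.const 2) hr)
  have ha : Primrec fun q : ((α × ℕ) × ℕ) × ℕ => q.1.1.1 :=
    Primrec.fst.comp (Primrec.fst.comp .fst)
  have hl : Primrec fun q : ((α × ℕ) × ℕ) × ℕ => q.1.1.2 :=
    Primrec.snd.comp (Primrec.fst.comp .fst)
  have hi : Primrec fun q : ((α × ℕ) × ℕ) × ℕ => q.1.2 := Primrec.snd.comp .fst
  exact primrecPred_forall_lt hL (primrecPred_forall_lt (hwidth.comp .fst)
    (primrecPred_forall_lt (hn.comp (Primrec.fst.comp .fst)) (Primrec.eq.comp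
      (primrec_digitArray (hp.comp ha) (hx.comp ha) (Primrec.succ.comp hl)
        (Primrec.nat_add.comp hi (hr.comp ha)) .snd)
      (primrec_stencilStep (hp.comp ha) (hn.comp ha) (hr.comp ha) (hM.comp ha) (hx.comp ha) hl hi
        .snd))))

theorem primrecPred_vanishesOnWindow (hp : Primrec p) (hn : Primrec n) (hL : Primrec L)
    (hN : Primrec N) (hx : Primrec x) :
    PrimrecPred fun a => VanishesOnWindow (n a) (L a) (N a) (digitArray (p a) (x a)) := by
  have hwidth : Primrec fun a => 2 * N a + 1 :=
    Primrec.succ.comp (Primrec.nat_mul.comp (Primrec.const 2) hN)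
  have ha : Primrec fun q : ((α × ℕ) × ℕ) × ℕ => q.1.1.1 :=
    Primrec.fst.comp (Primrec.fst.comp .fst)
  have hl : Primrec fun q : ((α × ℕ) × ℕ) × ℕ => q.1.1.2 :=
    Primrec.snd.comp (Primrec.fst.comp .fst)
  have hi : Primrec fun q : ((α × ℕ) × ℕ) × ℕ => q.1.2 := Primrec.snd.comp .fst
  exact primrecPred_forall_lt (Primrec.succ.comp hL) (primrecPred_forall_lt (hwidth.comp .fst)
    (primrecPred_forall_lt (hn.comp (Primrec.fst.comp .fst)) (Primrec.eq.comp
      (primrec_digitArray (hp.comp ha) (hx.comp ha) hl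
        (Primrec.nat_add.comp hi (Primrec.succ.comp (hN.comp ha))) .snd) (Primrec.const 0))))

theorem primrecPred_vanishesOnBorder (hp : Primrec p) (hn : Primrec n) (hN : Primrec N)
    (hx : Primrec x) :
    PrimrecPred fun a => VanishesOnBorder (n a) (N a) (digitArray (p a) (x a)) := by
  have hright : Primrec fun a => 3 * N a + 2 :=
    Primrec.nat_add.comp (Primrec.nat_mul.comp (Primrec.const 3) hN) (Primrec.const 2)
  have hdigit {f : α → ℕ} (hf : Primrec f) : PrimrecPred fun q : α × ℕ =>
      digitArray (p q.1) (x q.1) 0 (f q.1) q.2 = 0 :=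
    Primrec.eq.comp (primrec_digitArray (hp.comp .fst) (hx.comp .fst) (Primrec.const 0)
      (hf.comp .fst) .snd) (Primrec.const 0)
  exact primrecPred_forall_lt hn ((hdigit hright).and (hdigit hN))

theorem primrecPred_diagramCheck (hp : Primrec p) (hn : Primrec n) (hr : Primrec r)
    (hL : Primrec L) (hN : Primrec N) (hM : Primrec M) : PrimrecPred fun a =>
      DiagramCheck (p a) (n a) (r a) (L a) (N a) (listEntry (M a)) := by
  have hbound : Primrec fun a => p a ^ digitBound (n a) (L a) (N a) :=
    primrec_nat_pow.comp hp (Primrec₂.natPair.comp (Primrec.succ.comp hL) (Primrec₂.natPair.comp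
      (Primrec.nat_add.comp (Primrec.nat_mul.comp (Primrec.const 4) hN) (Primrec.const 3)) hn))
  have hp' := hp.comp (Primrec.fst (β := ℕ))
  have hn' := hn.comp (Primrec.fst (β := ℕ))
  have hL' := hL.comp (Primrec.fst (β := ℕ))
  have hN' := hN.comp (Primrec.fst (β := ℕ))
  exact primrecPred_forall_lt hbound (primrecPred_imp
    (primrecPred_evolves hp' hn' (hr.comp .fst) hL' hN' (hM.comp .fst) .snd)
    (primrecPred_imp (primrecPred_vanishesOnWindow hp' hn' hL' hN' .snd)
      (primrecPred_vanishesOnBorder hp' hn' hN' .snd)))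

end DiagramCheck

theorem primrecPred_codeCheck : PrimrecPred CodeCheck := by
  have hm : Primrec fun q : (ℕ × ℕ × ℕ × List (List (List ℕ))) × ℕ => q.1.1 :=
    Primrec.fst.comp .fst
  have htail : Primrec fun q : (ℕ × ℕ × ℕ × List (List (List ℕ))) × ℕ => q.1.2 :=
    Primrec.snd.comp .fst
  have hn := Primrec.fst.comp htail
  have hr := Primrec.fst.comp (Primrec.snd.comp htail)
  exact primrecPred_forall_lt (Primrec.succ.comp .fst)
    (primrecPred_imp (primrecPred_prime.comp .snd) (primrecPred_imp (primrecPred_dvd .snd hm)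
      (primrecPred_diagramCheck .snd hn hr hn (Primrec.nat_mul.comp hn hr)
        (Primrec.snd.comp (Primrec.snd.comp htail)))))

end Computability

end LinearCA

end

theorem mainTheorem5 :
    (∀ (m n : ℕ), 1 < m → 1 ≤ n → ∀ A : LinearCA.LinearRule m n,
      (LinearCA.PositivelyExpansive A.automaton ↔
        ∀ (p : ℕ) (_ : p.Prime) (h : p ∣ m),
          LinearCA.ExpansiveMatrix (LinearCA.reduceMod h A.assocMatrix))) ∧
    ∃ D : ℕ × ℕ × ℕ × List (List (List ℕ)) → Bool, Computable D ∧
      ∀ (m n : ℕ), 1 < m → 1 ≤ n → ∀ A : LinearCA.LinearRule m n,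
        (D A.code = true ↔ LinearCA.PositivelyExpansive A.automaton) := by
  constructor
  · intro m n hm hn A
    have : NeZero m := ⟨by omega⟩
    have : NeZero n := ⟨by omega⟩
    exact A.positivelyExpansive_iff_forall_expansiveMatrix
  · obtain ⟨_, hD⟩ := LinearCA.primrecPred_codeCheck
    refine ⟨_, hD.to_comp, fun m n hm hn A => decide_eq_true_iff.trans ?_⟩
    have : NeZero m := ⟨by omega⟩
    have : NeZero n := ⟨by omega⟩
    exact A.codeCheck_code_iff_positivelyExpansive
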